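/- Let $n,p\ge 1$ be integers, let $B$ be the open unit ball of $\mathbb{R}^n$, and let $\widehat B_p=\bigcup_{k=0}^{p-1}e^{k\pi i/p}B\subset\mathbb{C}^n$, where $e^{i\varphi}B=\{e^{i\varphi}x: x\in B\}$. Let $L^2(\widehat B_p)$ be the Hilbert space of (classes of) square-integrable functions on $\widehat B_p$ with the inner product $$\langle u,v\rangle=\frac1p\sum_{k=0}^{p-1}\int_B u(e^{k\pi i/p}y)\,\overline{v(e^{k\pi i/p}y)}\,dy ,\qquad \|u\|=\langle u,u\rangle^{1/2}.$$ A function on $\widehat B_p$ is called polyharmonic of order $p$ if it is the restriction to $\widehat B_p$ of a function $F$ which is holomorphic on a neighbourhood in $\mathbb{C}^n$ of $\{e^{i\psi}x:\psi\in\mathbb{R},\,x\in B\}$ and satisfies $\Delta^p(F|_B)=0$ on $B$, where $\Delta$ is the Laplacian of $\mathbb{R}^n$. Let $b_p^2(\widehat B_p)$ be the space of the functions on $\widehat B_p$ that are polyharmonic of order $p$ and have finite norm $\|u\|$. For every $x\in\widehat B_p$ there is a unique function $R_p(x,\cdot)\in b_p^2(\widehat B_p)$ such that $u(x)=\langle u,R_p(x,\cdot)\rangle$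 for every $u\in b_p^2(\widehat B_p)$ (the polyharmonic Bergman kernel), and it has the following properties: (1) $R_p(x,y)=\overline{R_p(y,x)}$ for all $x,y\in\widehat B_p$; (2) $\|R_p(x,\cdot)\|^2=R_p(x,x)$ for all $x\in\widehat B_p$; (3) for $u\in L^2(\widehat B_p)$ and $x\in\widehat B_p$ the integrals in $$Q[u](x)=\frac1p\sum_{k=0}^{p-1}\int_B u(e^{k\pi i/p}y)\,\overline{R_p(x,e^{k\pi i/p}y)}\,dy$$ converge, $Q[u]\in b_p^2(\widehat B_p)$, and $Q$ is the unique orthogonal projection of $L^2(\widehat B_p)$ onto $b_p^2(\widehat B_p)$. -/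

import Mathlib

open MeasureTheory Metric
open scoped ENNReal Laplacian

noncomputable section

namespace PolyBergman

/-- The inclusion of `ℝⁿ` into `ℂⁿ`. -/
def toComplex {n : ℕ} (x : EuclideanSpace ℝ (Fin n)) : EuclideanSpace ℂ (Fin n) :=
  WithLp.toLp 2 (fun j => (x j : ℂ))

/-- The rotated vector `e^{iφ} x` in `ℂⁿ`, for `x` in `ℝⁿ`. -/
def rotate {n : ℕ} (φ : ℝ) (x : EuclideanSpace ℝ (Fin n)) : EuclideanSpace ℂ (Fin n) :=
  Complex.exp ((φ : ℂ) * Complex.I) • toComplex x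

/-- The open unit ball `B` of `ℝⁿ`. -/
abbrev B (n : ℕ) : Set (EuclideanSpace ℝ (Fin n)) := ball 0 1

/-- The angle `k π / p`. -/
def angle (p : ℕ) (k : Fin p) : ℝ := ((k : ℕ) : ℝ) * Real.pi / (p : ℝ)

/-- The union of the rotated balls `e^{kπi/p} B`, `k = 0, …, p - 1`. -/
def hatB (n p : ℕ) : Set (EuclideanSpace ℂ (Fin n)) :=
  ⋃ k : Fin p, rotate (angle p k) '' B n

/-- The union of all rotated balls `e^{iψ} B`, `ψ` real. -/
def allRotations (n : ℕ) : Set (EuclideanSpace ℂ (Fin n)) :=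
  {z | ∃ ψ : ℝ, ∃ x ∈ B n, z = rotate ψ x}

/-- The map `y ↦ e^{kπi/p} y` from `B` to the union of the rotated balls. -/
def rot {n p : ℕ} (k : Fin p) (y : B n) : hatB n p :=
  ⟨rotate (angle p k) y, Set.mem_iUnion.2 ⟨k, Set.mem_image_of_mem _ y.2⟩⟩

/-- Polyharmonic functions of order `p` on an open set `G` of `ℝⁿ`: real analytic functions
with vanishing `p`-th iterated Laplacian. -/
def IsPolyharmonicOn {n : ℕ} (p : ℕ) (f : EuclideanSpace ℝ (Fin n) → ℂ)
    (G : Set (EuclideanSpace ℝ (Fin n))) : Prop :=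
  AnalyticOnNhd ℝ f G ∧ ∀ x ∈ G, (Laplacian.laplacian^[p] f) x = 0

/-- `u` is a polyharmonic function of order `p` on the union of the rotated balls: it comes from
a polyharmonic function of order `p` on `B` through the holomorphic extension of the latter to
(a neighbourhood of) the union of all the sets `e^{iψ} B`. -/
def IsPolyharmonic {n p : ℕ} (u : hatB n p → ℂ) : Prop :=
  ∃ F : EuclideanSpace ℂ (Fin n) → ℂ,
    AnalyticOnNhd ℂ F (allRotations n) ∧
    IsPolyharmonicOn p (fun x => F (toComplex x)) (B n) ∧
    ∀ z : hatB n p, u z = F z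

/-- Lebesgue measure on the unit ball `B` of `ℝⁿ`. -/
def volB (n : ℕ) : Measure (B n) := Measure.comap Subtype.val volume

/-- The measure `f ↦ (1/p) ∑ₖ ∫_B f(e^{kπi/p} y) dy` on the union of the rotated balls. -/
def hatMeasure (n p : ℕ) : Measure (hatB n p) :=
  (p : ℝ≥0∞)⁻¹ • ∑ k : Fin p, Measure.map (rot k) (volB n)

/-- The Hilbert space `L²` of the union of the rotated balls. -/
abbrev L2 (n p : ℕ) : Type := Lp ℂ 2 (hatMeasure n p)

/-- The pairing `⟨u, v⟩ = (1/p) ∑ₖ ∫_B u(e^{kπi/p} y) conj(v(e^{kπi/p} y)) dy`. -/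
def pairing {n p : ℕ} (u v : hatB n p → ℂ) : ℂ :=
  (1 / (p : ℂ)) * ∑ k : Fin p, ∫ y : B n, u (rot k y) * (starRingEnd ℂ) (v (rot k y)) ∂(volB n)

/-- The norm `((1/p) ∑ₖ ∫_B |u(e^{kπi/p} y)|² dy)^{1/2}` of a square integrable function. -/
def bergmanNorm {n p : ℕ} (u : hatB n p → ℂ) : ℝ :=
  Real.sqrt ((1 / (p : ℝ)) * ∑ k : Fin p, ∫ y : B n, ‖u (rot k y)‖ ^ 2 ∂(volB n))

/-- The polyharmonic Bergman space: square integrable polyharmonic functions of order `p`. -/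
def bergmanSpace (n p : ℕ) : Set (hatB n p → ℂ) :=
  {u | IsPolyharmonic u ∧ MemLp u 2 (hatMeasure n p)}

/-- The Bergman space as a subset of `L²`: the classes of the functions in it. -/
def bergmanL2 (n p : ℕ) : Set (L2 n p) :=
  {f | ∃ u ∈ bergmanSpace n p, (f : hatB n p → ℂ) =ᵐ[hatMeasure n p] u}

/-- `r` is the element of the Bergman space that represents the evaluation at `x`. -/
def Represents {n p : ℕ} (x : hatB n p) (r : hatB n p → ℂ) : Prop :=
  r ∈ bergmanSpace n p ∧ ∀ u ∈ bergmanSpace n p, u x = pairing u r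

/-- The polyharmonic Bergman kernel: `bergmanKernel x` is the function in the Bergman space that
represents the evaluation at `x`. -/
def bergmanKernel {n p : ℕ} (x : hatB n p) : hatB n p → ℂ :=
  Classical.epsilon (Represents x)

/-- The integral operator `Q[u](x) = (1/p) ∑ₖ ∫_B u(e^{kπi/p} y) conj(R(x, e^{kπi/p} y)) dy`. -/
def Q {n p : ℕ} (u : hatB n p → ℂ) (x : hatB n p) : ℂ :=
  (1 / (p : ℂ)) * ∑ k : Fin p,
    ∫ y : B n, u (rot k y) * (starRingEnd ℂ) (bergmanKernel x (rot k y)) ∂(volB n)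

end PolyBergman

end

open Polynomial

/-! Everything follows from Hilbert space theory once two facts are known: evaluation at a point of
the rotated balls is bounded on the Bergman space, and this space is closed in `L²`. Riesz
representation then gives the kernel, testing kernels against each other gives (1) and (2), and `Q`
is the orthogonal projection because pairing with `R(x, ·)` sees only the component in the Bergman
space.

Both facts come from the expansion `F = ∑ A_m` into homogeneous polynomials at `0`. It converges on
all rotated balls, since these are swept out by discs in complex lines through `0`, and each `A_m`
is again polyharmonic of order `p`.

Bessel inequality (`ballNorm_homPart_le`): `‖A_m‖` in `L²(B)` is at most `‖u‖`. The cross terms of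
`A_m` and `A_m'` vanish for `m ≠ m'` by one of three mechanisms (`sum_exp_mul_setIntegral_eq_zero`).
If `m + m'` is odd, parity applies. If `|m - m'| ≥ 2p`, a Green identity makes the two orthogonal on
every sphere (`sphereIntegral_mul_eq_zero`). Otherwise `m - m' = 2s` with `0 < |s| < p`, and the
average over the `p` rotations is a vanishing sum of roots of unity.

Decay (`exists_norm_eval_le`): near each point of the rotated balls, `|A(z)| ≤ C ρ^m ‖A‖` with `ρ <
1` for every homogeneous `A` of degree `m`. An `L²` Bernstein-Walsh inequality bounds `A` near real
points with a loss per degree as close to `1` as desired, and homogeneity gains a factor smaller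
than `1` per degree.

Together they bound `∑ A_m` by a multiple of `‖u‖`, locally uniformly on one open set `decaySet`
that does not depend on `u`. Evaluation is therefore bounded, and an `L²` limit of Bergman functions
is a locally uniform limit of holomorphic functions, which is holomorphic and polyharmonic by
Weierstrass's theorem. -/

namespace PolyBergman

/-! ### The `L²` Bernstein-Walsh inequality in one variable -/

/-- The constant in the `L²` Bernstein-Walsh inequality on an interval. -/
noncomputable def walshConst (s : ℝ) : ℝ := 4 / (Real.pi * (1 - s) * (1 - s ^ 2) ^ 2)

theorem walshConst_nonneg {s : ℝ} (hs : s < 1) : 0 ≤ walshConst s := by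
  have := Real.pi_pos
  have : 0 < 1 - s := by linarith
  unfold walshConst
  positivity

/-- Because `sin² ≤ |sin|`, the substitution `x = cos t` on each half period bounds that half by
four times the integral on the right. -/
theorem integral_sin_sq_mul_comp_cos_le {g : ℝ → ℝ} (hg : Continuous g) (h0 : ∀ t, 0 ≤ g t) :
    ∫ t in (0 : ℝ)..2 * Real.pi, 4 * Real.sin t ^ 2 * g (Real.cos t) ≤
      8 * ∫ t in (-1 : ℝ)..1, g t := by
  have hc : Continuous fun t => 4 * Real.sin t ^ 2 * g (Real.cos t) := by fun_prop
  rw [← intervalIntegral.integral_add_adjacent_intervals (b := Real.pi)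
    (hc.intervalIntegrable _ _) (hc.intervalIntegrable _ _)]
  have h1 : ∫ t in (0 : ℝ)..Real.pi, (g ∘ Real.cos) t * (-Real.sin t) =
      ∫ t in (1 : ℝ)..(-1), g t := by
    rw [intervalIntegral.integral_comp_mul_deriv (fun x _ => Real.hasDerivAt_cos x)
      (by fun_prop) hg]
    simp
  have h2 : ∫ t in Real.pi..2 * Real.pi, (g ∘ Real.cos) t * (-Real.sin t) =
      ∫ t in (-1 : ℝ)..1, g t := by
    rw [intervalIntegral.integral_comp_mul_deriv (fun x _ => Real.hasDerivAt_cos x)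
      (by fun_prop) hg]
    simp
  have hle : ∫ t in (0 : ℝ)..Real.pi, 4 * Real.sin t ^ 2 * g (Real.cos t) ≤
      ∫ t in (0 : ℝ)..Real.pi, (-4) * ((g ∘ Real.cos) t * (-Real.sin t)) := by
    refine intervalIntegral.integral_mono_on Real.pi_pos.le (hc.intervalIntegrable _ _)
      (Continuous.intervalIntegrable (by fun_prop) _ _) fun t ht => ?_
    have h3 := Real.sin_nonneg_of_mem_Icc ht
    have h4 := Real.sin_le_one t
    have h5 := h0 (Real.cos t)
    simp only [Function.comp]
    nlinarith [mul_nonneg (mul_nonneg h3 h5) (sub_nonneg.2 h4)]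
  have hle' : ∫ t in Real.pi..2 * Real.pi, 4 * Real.sin t ^ 2 * g (Real.cos t) ≤
      ∫ t in Real.pi..2 * Real.pi, 4 * ((g ∘ Real.cos) t * (-Real.sin t)) := by
    refine intervalIntegral.integral_mono_on (by linarith [Real.pi_pos])
      (hc.intervalIntegrable _ _) (Continuous.intervalIntegrable (by fun_prop) _ _) fun t ht => ?_
    have h3 : 0 ≤ - Real.sin t := by
      have := Real.sin_nonneg_of_mem_Icc (x := t - Real.pi) ⟨by linarith [ht.1], by linarith [ht.2]⟩
      rwa [Real.sin_sub_pi] at this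
    have h4 := Real.neg_one_le_sin t
    have h5 := h0 (Real.cos t)
    simp only [Function.comp]
    nlinarith [mul_nonneg (mul_nonneg h3 h5) (by linarith : 0 ≤ 1 + Real.sin t)]
  rw [intervalIntegral.integral_const_mul, h1, intervalIntegral.integral_symm (-1) 1] at hle
  rw [intervalIntegral.integral_const_mul, h2] at hle'
  linarith

/-- Cauchy's formula is applied to `G ^ 2`, which gives an `L²` bound without Cauchy-Schwarz; the
kernel is at most `1 / (1 - s)`. -/
theorem norm_sq_le_circle_average {G : ℂ → ℂ} (hG : Differentiable ℂ G) {s : ℝ} (hs1 : s < 1)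
    {w : ℂ} (hw : ‖w‖ = s) :
    ‖G w‖ ^ 2 ≤ (2 * Real.pi)⁻¹ * (1 - s)⁻¹ *
      ∫ t in (0 : ℝ)..2 * Real.pi, ‖G (circleMap 0 1 t)‖ ^ 2 := by
  have hpi := Real.pi_pos
  have hw' : w ∈ ball (0 : ℂ) 1 := by simpa [hw] using hs1
  have key := Complex.two_pi_I_inv_smul_circleIntegral_sub_inv_smul_of_differentiable_on_off_countable
    (f := fun z => G z ^ 2) (R := 1) (c := 0) (w := w) Set.countable_empty hw'
    (hG.continuous.pow 2).continuousOn (fun x _ => (hG x).pow 2)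
  have hGc := hG.continuous
  rw [← norm_pow, ← key, norm_smul]
  have hn : ‖(2 * Real.pi * Complex.I : ℂ)⁻¹‖ = (2 * Real.pi)⁻¹ := by
    simp [abs_of_pos hpi]
  rw [hn, mul_assoc]
  gcongr
  rw [circleIntegral, ← intervalIntegral.integral_const_mul]
  have hb : ∀ t : ℝ, 1 - s ≤ ‖circleMap 0 1 t - w‖ := fun t => by
    have := norm_sub_norm_le (circleMap 0 1 t) w
    simpa [hw] using this
  have hne : ∀ t : ℝ, circleMap 0 1 t - w ≠ 0 := fun t => by
    rw [← norm_pos_iff]; linarith [hb t]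
  refine (intervalIntegral.norm_integral_le_integral_norm (by positivity)).trans ?_
  refine intervalIntegral.integral_mono_on (by positivity)
    (Continuous.intervalIntegrable ?_ _ _) (Continuous.intervalIntegrable ?_ _ _) fun t _ => ?_
  · simp only [deriv_circleMap]
    exact (((continuous_circleMap 0 1).mul continuous_const).smul
      ((((continuous_circleMap 0 1).sub continuous_const).inv₀ hne).smul
        ((hGc.comp (continuous_circleMap 0 1)).pow 2))).norm
  · exact continuous_const.mul (((hGc.comp (continuous_circleMap 0 1)).norm).pow 2)
  · simp only [norm_smul, norm_inv, deriv_circleMap, norm_mul, norm_circleMap_zero, norm_pow]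
    simp only [abs_one, Complex.norm_I, mul_one, one_mul]
    gcongr
    exact hb t

/-- The substitution `z = (w + w⁻¹) / 2` sends the unit circle onto `[-1, 1]`. The factor `w ^ m`
removes the pole of the composition at `0`, and `w ^ 2 - 1` has modulus `2 |sin t|` on the circle,
which compensates the endpoint singularity `1 / √(1 - x²)` of the pushed measure. -/
theorem norm_sq_eval_joukowski_le {s : ℝ} (hs0 : 0 < s) (hs1 : s < 1) {m : ℕ} {q : ℂ[X]}
    (hq : q.natDegree ≤ m) {w : ℂ} (hw : ‖w‖ = s) :
    ‖q.eval ((w + w⁻¹) / 2)‖ ^ 2 ≤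
      walshConst s * s⁻¹ ^ (2 * m) * ∫ t in (-1 : ℝ)..1, ‖q.eval (t : ℂ)‖ ^ 2 := by
  -- This is `(w² - 1) wᵐ q((w + w⁻¹) / 2)` with the powers of `w⁻¹` already cancelled, so that it
  -- is visibly entire.
  set G : ℂ → ℂ := fun w => (w ^ 2 - 1) *
    ∑ k ∈ Finset.range (m + 1), q.coeff k * (w ^ (m - k) * ((w ^ 2 + 1) / 2) ^ k) with hGdef
  have hG : Differentiable ℂ G := by simp only [hGdef]; fun_prop
  have hGw : ∀ w : ℂ, w ≠ 0 → G w = (w ^ 2 - 1) * (w ^ m * q.eval ((w + w⁻¹) / 2)) := by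
    intro w hw
    simp only [hGdef]
    rw [Polynomial.eval_eq_sum_range' (Nat.lt_succ_of_le hq)]
    congr 1
    rw [Finset.mul_sum]
    refine Finset.sum_congr rfl fun k hk => ?_
    have hk' : k ≤ m := by simpa [Nat.lt_succ_iff] using hk
    have : (w + w⁻¹) / 2 = w⁻¹ * ((w ^ 2 + 1) / 2) := by field_simp
    rw [this, mul_pow, ← Nat.sub_add_cancel hk', pow_add]
    simp only [Nat.add_sub_cancel]
    rw [inv_pow]
    have : w ^ k ≠ 0 := pow_ne_zero _ hw
    field_simp
  have hcirc : ∀ t : ℝ, ‖G (circleMap 0 1 t)‖ ^ 2 =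
      4 * Real.sin t ^ 2 * ‖q.eval ((Real.cos t : ℝ) : ℂ)‖ ^ 2 := by
    intro t
    have hne : circleMap 0 1 t ≠ 0 := by simp
    have hcm : circleMap 0 1 t = Complex.exp (t * Complex.I) := by simp [circleMap]
    have hinv : (circleMap 0 1 t)⁻¹ = Complex.exp (-(t * Complex.I)) := by
      rw [hcm, Complex.exp_neg]
    have hcos : (circleMap 0 1 t + (circleMap 0 1 t)⁻¹) / 2 = ((Real.cos t : ℝ) : ℂ) := by
      rw [hinv, hcm, Complex.ofReal_cos, Complex.cos, neg_mul]
    have hsin : (circleMap 0 1 t) ^ 2 - 1 =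
        circleMap 0 1 t * (2 * Complex.I * ((Real.sin t : ℝ) : ℂ)) := by
      have h1 : 2 * Complex.I * ((Real.sin t : ℝ) : ℂ) =
          circleMap 0 1 t - (circleMap 0 1 t)⁻¹ := by
        rw [hinv, hcm, Complex.ofReal_sin, Complex.sin, neg_mul]
        linear_combination (Complex.exp (-(↑t * Complex.I)) - Complex.exp (↑t * Complex.I)) *
          Complex.I_sq
      rw [h1, mul_sub, mul_inv_cancel₀ hne, sq]
    rw [hGw _ hne, hcos, hsin]
    simp only [norm_mul, norm_pow, norm_circleMap_zero, abs_one, one_mul, one_pow, Complex.norm_I,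
      mul_one, Complex.norm_real, Real.norm_eq_abs, mul_pow, sq_abs]
    norm_num
  have h1 := norm_sq_le_circle_average hG hs1 hw
  simp only [hcirc] at h1
  have h2 := integral_sin_sq_mul_comp_cos_le (g := fun t : ℝ => ‖q.eval (t : ℂ)‖ ^ 2)
    (by fun_prop) (fun t => by positivity)
  have hw0 : w ≠ 0 := by rw [← norm_pos_iff, hw]; exact hs0
  have hGn : (1 - s ^ 2) ^ 2 * (s ^ (2 * m) * ‖q.eval ((w + w⁻¹) / 2)‖ ^ 2) ≤ ‖G w‖ ^ 2 := by
    rw [hGw _ hw0]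
    simp only [norm_mul, norm_pow, hw, mul_pow]
    rw [← pow_mul, mul_comm m 2]
    have : 1 - s ^ 2 ≤ ‖w ^ 2 - 1‖ := by
      have := norm_sub_norm_le (1 : ℂ) (w ^ 2)
      rw [norm_sub_rev] at this
      simpa [hw] using this
    have : 0 ≤ 1 - s ^ 2 := by nlinarith
    gcongr
  have hpi := Real.pi_pos
  have hs1' : 0 < 1 - s := by linarith
  have hs2 : 0 < 1 - s ^ 2 := by nlinarith
  set N := ∫ t in (-1 : ℝ)..1, ‖q.eval (t : ℂ)‖ ^ 2
  -- Dividing by the left factors gives the constant `8 / (2π (1 - s) (1 - s²)²)`, which is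
  -- `walshConst s`.
  have h3 : (1 - s ^ 2) ^ 2 * (s ^ (2 * m) * ‖q.eval ((w + w⁻¹) / 2)‖ ^ 2) ≤
      (2 * Real.pi)⁻¹ * (1 - s)⁻¹ * (8 * N) :=
    hGn.trans (h1.trans (by gcongr))
  have hpos : 0 < (1 - s ^ 2) ^ 2 * s ^ (2 * m) := by positivity
  rw [← mul_assoc, ← le_div_iff₀' hpos] at h3
  refine h3.trans_eq ?_
  unfold walshConst
  rw [inv_pow]
  field_simp
  ring

/-- The `L²` Bernstein-Walsh inequality on `[-1, 1]`. -/
theorem norm_sq_eval_le_integral {s : ℝ} (hs0 : 0 < s) (hs1 : s < 1) {m : ℕ} {q : ℂ[X]}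
    (hq : q.natDegree ≤ m) {z : ℂ} (hz : ‖z‖ ≤ (s⁻¹ - s) / 2) :
    ‖q.eval z‖ ^ 2 ≤
      walshConst s * s⁻¹ ^ (2 * m) * ∫ t in (-1 : ℝ)..1, ‖q.eval (t : ℂ)‖ ^ 2 := by
  set D := walshConst s * s⁻¹ ^ (2 * m) * ∫ t in (-1 : ℝ)..1, ‖q.eval (t : ℂ)‖ ^ 2
  have hs1i : 1 < s⁻¹ := (one_lt_inv₀ hs0).2 hs1
  -- The point `w = z + √(z² - 1)` solves `w + w⁻¹ = 2z`.
  obtain ⟨r, hr⟩ := IsAlgClosed.exists_pow_nat_eq (z ^ 2 - 1) (n := 2) (by norm_num)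
  set w := z + r with hwdef
  have hquad : w * (2 * z - w) = 1 := by rw [hwdef]; linear_combination -hr
  have hw0 : w ≠ 0 := left_ne_zero_of_mul_eq_one hquad
  have hwz : (w + w⁻¹) / 2 = z := by
    rw [inv_eq_of_mul_eq_one_right hquad]; ring
  have hwinv : 0 < ‖w‖ := norm_pos_iff.2 hw0
  -- The left side is at most `|w + w⁻¹| = 2|z|`; this puts `w` in the closed annulus `s ≤ |w| ≤
  -- s⁻¹`.
  have habs : |‖w‖ - ‖w‖⁻¹| ≤ s⁻¹ - s := by
    have h1 : |‖w‖ - ‖w⁻¹‖| ≤ ‖w + w⁻¹‖ := by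
      simpa using abs_norm_sub_norm_le w (-w⁻¹)
    have h2 : w + w⁻¹ = 2 * z := by rw [← hwz]; ring
    rw [h2, norm_mul, norm_inv] at h1
    simp only [Complex.norm_ofNat] at h1
    linarith
  have hws : s ≤ ‖w‖ := by
    by_contra! h
    have := inv_strictAnti₀ hwinv h
    have := (abs_le.1 habs).1
    linarith
  have hws' : ‖w‖ ≤ s⁻¹ := by
    by_contra! h
    have h3 := inv_strictAnti₀ (by positivity) h
    rw [inv_inv] at h3
    have := (abs_le.1 habs).2
    linarith
  have hjou : ∀ v : ℂ, ‖v‖ = s ∨ ‖v‖ = s⁻¹ → ‖q.eval ((v + v⁻¹) / 2)‖ ^ 2 ≤ D := by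
    rintro v (hv | hv)
    · exact norm_sq_eval_joukowski_le hs0 hs1 hq hv
    · have := norm_sq_eval_joukowski_le hs0 hs1 hq (w := v⁻¹) (by rw [norm_inv, hv, inv_inv])
      rwa [inv_inv, add_comm] at this
  -- The maximum principle on this annulus reduces to its two boundary circles, which have the same
  -- image because `w` and `w⁻¹` give the same point.
  set U : Set ℂ := norm ⁻¹' Set.Ioo s s⁻¹
  rcases hws.eq_or_lt with h | h
  · rw [← hwz]; exact hjou w (Or.inl h.symm)
  rcases hws'.eq_or_lt with h' | h'
  · rw [← hwz]; exact hjou w (Or.inr h')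
  have hfr : frontier U ⊆ norm ⁻¹' {s, s⁻¹} := by
    have := continuous_norm.frontier_preimage_subset (X := ℂ) (Set.Ioo s s⁻¹)
    rwa [frontier_Ioo (by linarith)] at this
  have hcl : ∀ v ∈ closure U, v ≠ 0 := fun v hv => by
    have h4 : v ∈ norm ⁻¹' Set.Icc s s⁻¹ := by
      have := continuous_norm.closure_preimage_subset (X := ℂ) (Set.Ioo s s⁻¹) hv
      rwa [closure_Ioo (by linarith)] at this
    rw [← norm_pos_iff]
    exact hs0.trans_le h4.1
  have hUb : Bornology.IsBounded U := by
    refine (isBounded_ball (x := (0 : ℂ)) (r := s⁻¹)).subset fun v hv => ?_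
    simpa using hv.2
  have hd : DiffContOnCl ℂ (fun v : ℂ => q.eval ((v + v⁻¹) / 2)) U := by
    refine DifferentiableOn.diffContOnCl fun v hv => ?_
    have := hcl v hv
    have h5 : DifferentiableAt ℂ (fun v : ℂ => (v + v⁻¹) / 2) v := by fun_prop (disch := exact this)
    exact ((q.differentiable _).comp v h5).differentiableWithinAt
  have := Complex.norm_le_of_forall_mem_frontier_norm_le hUb hd (C := Real.sqrt D)
    (fun v hv => Real.le_sqrt_of_sq_le (hjou v (hfr hv))) (z := w) (subset_closure ⟨h, h'⟩)
  simp only [hwz] at this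
  have hD : 0 ≤ D := (sq_nonneg _).trans (hjou (s : ℂ) (Or.inl (by simp [abs_of_pos hs0])))
  calc ‖q.eval z‖ ^ 2 ≤ Real.sqrt D ^ 2 := by gcongr
    _ = D := Real.sq_sqrt hD

/-- The `L²` Bernstein-Walsh inequality on an interval. -/
theorem enorm_sq_eval_le_lintegral {s : ℝ} (hs0 : 0 < s) (hs1 : s < 1) {m : ℕ} {q : ℂ[X]}
    (hq : q.natDegree ≤ m) {c δ : ℝ} (hδ : 0 < δ) {z : ℂ}
    (hz : ‖z - c‖ ≤ δ * ((s⁻¹ - s) / 2)) :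
    ‖q.eval z‖ₑ ^ 2 ≤ ENNReal.ofReal (walshConst s * s⁻¹ ^ (2 * m) * δ⁻¹) *
      ∫⁻ t in Set.Icc (c - δ) (c + δ), ‖q.eval (t : ℂ)‖ₑ ^ 2 := by
  set q' : ℂ[X] := q.comp (Polynomial.C (δ : ℂ) * Polynomial.X + Polynomial.C (c : ℂ))
  have hq' : q'.natDegree ≤ m := by
    refine Polynomial.natDegree_comp_le.trans ?_
    exact (Nat.mul_le_mul hq Polynomial.natDegree_linear_le).trans_eq (mul_one m)
  have hδ' : (δ : ℂ) ≠ 0 := by exact_mod_cast hδ.ne'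
  have hev : ∀ t : ℂ, q'.eval t = q.eval (δ * t + c) := fun t => by simp [q']
  have hz' : ‖(z - c) / δ‖ ≤ (s⁻¹ - s) / 2 := by
    rw [norm_div, Complex.norm_real, Real.norm_of_nonneg hδ.le, div_le_iff₀ hδ]
    linarith
  have h := norm_sq_eval_le_integral hs0 hs1 hq' hz'
  have hz2 : (δ : ℂ) * ((z - c) / δ) + c = z := by field_simp; ring
  simp only [hev, hz2] at h
  have hsub : ∫ t in (-1 : ℝ)..1, ‖q.eval ((δ : ℂ) * t + c)‖ ^ 2 =
      δ⁻¹ * ∫ t in (c - δ)..(c + δ), ‖q.eval (t : ℂ)‖ ^ 2 := by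
    have := intervalIntegral.integral_comp_mul_add (a := -1) (b := 1)
      (fun t : ℝ => ‖q.eval (t : ℂ)‖ ^ 2) hδ.ne' c
    push_cast at this
    rw [this, smul_eq_mul]
    congr 2 <;> ring
  rw [hsub, ← mul_assoc] at h
  have hl : ENNReal.ofReal (‖q.eval z‖ ^ 2) = ‖q.eval z‖ₑ ^ 2 := by
    rw [ENNReal.ofReal_pow (norm_nonneg _), ofReal_norm]
  have hK : 0 ≤ walshConst s * s⁻¹ ^ (2 * m) * δ⁻¹ := by
    have := walshConst_nonneg hs1
    positivity
  rw [← hl]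
  refine (ENNReal.ofReal_le_ofReal h).trans_eq ?_
  rw [ENNReal.ofReal_mul hK, intervalIntegral.integral_of_le (by linarith),
    ← integral_Icc_eq_integral_Ioc, ofReal_integral_eq_lintegral_ofReal]
  · congr 2
    ext t
    rw [ENNReal.ofReal_pow (norm_nonneg _), ofReal_norm]
  · exact (Continuous.continuousOn (by fun_prop)).integrableOn_compact isCompact_Icc
  · exact Filter.Eventually.of_forall fun t => by positivity

/-! ### Several variables: geometric decay of homogeneous polynomials -/

theorem eval_smul_of_isHomogeneous {σ R : Type*} [CommSemiring R] {A : MvPolynomial σ R} {m : ℕ}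
    (hA : A.IsHomogeneous m) (c : R) (z : σ → R) :
    MvPolynomial.eval (c • z) A = c ^ m * MvPolynomial.eval z A := by
  rw [MvPolynomial.eval_eq, MvPolynomial.eval_eq, Finset.mul_sum]
  refine Finset.sum_congr rfl fun d hd => ?_
  have hdeg := hA (MvPolynomial.mem_support_iff.1 hd)
  simp only [Pi.smul_apply, smul_eq_mul, mul_pow, Finset.prod_mul_distrib,
    Finset.prod_pow_eq_pow_sum]
  rw [← hdeg, Finsupp.weight_apply, Finsupp.sum]
  simp only [Pi.one_apply, smul_eq_mul, mul_one]
  ring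

/-- Freezing all coordinates but one leaves a polynomial of degree at most `m` in one variable. The
interval measure is pushed forward to `ℂ` so that the integrand stays a function on `ℂⁿ` and the
estimate can be iterated over coordinates that are still complex. -/
theorem enorm_sq_eval_le_lintegral_update {s : ℝ} (hs0 : 0 < s) (hs1 : s < 1) {m n : ℕ}
    {A : MvPolynomial (Fin n) ℂ} (hA : A.totalDegree ≤ m) {c δ : ℝ} (hδ : 0 < δ)
    (z : Fin n → ℂ) (i : Fin n) (hz : ‖z i - c‖ ≤ δ * ((s⁻¹ - s) / 2)) :
    ‖MvPolynomial.eval z A‖ₑ ^ 2 ≤ ENNReal.ofReal (walshConst s * s⁻¹ ^ (2 * m) * δ⁻¹) *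
      ∫⁻ t, ‖MvPolynomial.eval (Function.update z i t) A‖ₑ ^ 2
        ∂(volume.restrict (Set.Icc (c - δ) (c + δ))).map Complex.ofReal := by
  classical
  set q : ℂ[X] := MvPolynomial.aeval
    (fun j => if j = i then Polynomial.X else Polynomial.C (z j)) A
  have hq : q.natDegree ≤ m := by
    refine (MvPolynomial.aeval_natDegree_le (n := 1) A hA _ fun j => ?_).trans_eq (mul_one m)
    split_ifs <;> simp
  have hev : ∀ t : ℂ, q.eval t = MvPolynomial.eval (Function.update z i t) A := by
    intro t
    simp only [q]
    rw [MvPolynomial.aeval_def, MvPolynomial.polynomial_eval_eval₂, ← MvPolynomial.eval₂_id]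
    congr 1
    · ext; simp
    · ext j
      by_cases h : j = i
      · subst h; simp
      · simp [h]
  have h := enorm_sq_eval_le_lintegral hs0 hs1 hq hδ hz
  simp only [hev, Function.update_eq_self] at h
  rwa [MeasureTheory.lintegral_map _ Complex.measurable_ofReal]
  have : Continuous fun t => MvPolynomial.eval (Function.update z i t) A := by
    simp only [← hev]; exact q.continuous
  exact (by fun_prop : Continuous _).measurable

theorem enorm_sq_eval_le_lintegral_pi {s : ℝ} (hs0 : 0 < s) (hs1 : s < 1) {m n : ℕ}
    {A : MvPolynomial (Fin n) ℂ} (hA : A.totalDegree ≤ m) {c : Fin n → ℝ} {δ : ℝ} (hδ : 0 < δ)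
    (z : Fin n → ℂ) (hz : ∀ i, ‖z i - c i‖ ≤ δ * ((s⁻¹ - s) / 2)) :
    ‖MvPolynomial.eval z A‖ₑ ^ 2 ≤ ENNReal.ofReal (walshConst s * s⁻¹ ^ (2 * m) * δ⁻¹) ^ n *
      ∫⁻ t in Set.univ.pi fun i => Set.Icc (c i - δ) (c i + δ),
        ‖MvPolynomial.eval (fun i => (t i : ℂ)) A‖ₑ ^ 2 := by
  classical
  set K := ENNReal.ofReal (walshConst s * s⁻¹ ^ (2 * m) * δ⁻¹)
  set μ : Fin n → Measure ℂ := fun i =>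
    (volume.restrict (Set.Icc (c i - δ) (c i + δ))).map Complex.ofReal
  have hsf : ∀ i, SigmaFinite (μ i) := fun i => by
    have : IsFiniteMeasure (μ i) := by simp only [μ]; infer_instance
    infer_instance
  set f : (Fin n → ℂ) → ℝ≥0∞ := fun z => ‖MvPolynomial.eval z A‖ₑ ^ 2
  have hf : Measurable f :=
    ((MvPolynomial.continuous_eval A).enorm.measurable).pow_const 2
  -- Each coordinate integrated costs one factor `K`; coordinates outside `S` remain arbitrary
  -- complex numbers.
  have key : ∀ (S : Finset (Fin n)) (z : Fin n → ℂ),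
      (∀ i ∈ S, ‖z i - c i‖ ≤ δ * ((s⁻¹ - s) / 2)) →
      f z ≤ K ^ S.card * (∫⋯∫⁻_S, f ∂μ) z := by
    intro S
    induction S using Finset.induction_on with
    | empty => intro z _; simp
    | insert i S hi ih =>
      intro z hz
      calc f z ≤ K * ∫⁻ t, f (Function.update z i t) ∂(μ i) :=
            enorm_sq_eval_le_lintegral_update hs0 hs1 hA hδ z i
              (hz i (Finset.mem_insert_self i S))
        _ ≤ K * ∫⁻ t, K ^ S.card * (∫⋯∫⁻_S, f ∂μ) (Function.update z i t) ∂(μ i) := by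
            gcongr with t
            refine ih _ fun j hj => ?_
            have : j ≠ i := fun h => hi (h ▸ hj)
            rw [Function.update_of_ne this]
            exact hz j (Finset.mem_insert_of_mem hj)
        _ = K ^ (insert i S).card * (∫⋯∫⁻_(insert i S), f ∂μ) z := by
            rw [lmarginal_insert f hf hi, lintegral_const_mul' _ _ (by finiteness),
              Finset.card_insert_of_notMem hi]
            ring
  have h := key Finset.univ z fun i _ => hz i
  rw [← lintegral_eq_lmarginal_univ, Finset.card_univ, Fintype.card_fin] at h
  refine h.trans_eq ?_
  rw [volume_pi, Measure.restrict_pi_pi]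
  have hmap := Measure.pi_map_pi (μ := fun i => volume.restrict (Set.Icc (c i - δ) (c i + δ)))
    (f := fun (_ : Fin n) (t : ℝ) => (t : ℂ)) (hμ := hsf)
    (fun i => Complex.measurable_ofReal.aemeasurable)
  change _ = Measure.pi μ at hmap
  rw [← hmap, lintegral_map hf (by fun_prop)]

/-- The `L²` norm over the unit ball of `ℝⁿ` of a polynomial. -/
noncomputable def ballNorm {n : ℕ} (A : MvPolynomial (Fin n) ℂ) : ℝ :=
  Real.sqrt (∫ y in B n, ‖MvPolynomial.eval (toComplex y).ofLp A‖ ^ 2)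

theorem ballNorm_nonneg {n : ℕ} (A : MvPolynomial (Fin n) ℂ) : 0 ≤ ballNorm A := Real.sqrt_nonneg _

theorem continuous_toComplex {n : ℕ} : Continuous (toComplex (n := n)) := by
  unfold toComplex
  fun_prop

theorem continuous_eval_ofLp {n : ℕ} (A : MvPolynomial (Fin n) ℂ) :
    Continuous fun z : EuclideanSpace ℂ (Fin n) => MvPolynomial.eval z.ofLp A :=
  (MvPolynomial.continuous_eval A).comp (PiLp.continuous_ofLp 2 _)

theorem ofReal_ballNorm_sq {n : ℕ} (A : MvPolynomial (Fin n) ℂ) :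
    ENNReal.ofReal (ballNorm A ^ 2) = ∫⁻ y in B n, ‖MvPolynomial.eval (toComplex y).ofLp A‖ₑ ^ 2 := by
  have hc : Continuous fun y => ‖MvPolynomial.eval (toComplex (n := n) y).ofLp A‖ ^ 2 :=
    ((continuous_eval_ofLp A).comp continuous_toComplex).norm.pow 2
  rw [ballNorm, Real.sq_sqrt (integral_nonneg fun y => by positivity),
    ofReal_integral_eq_lintegral_ofReal]
  · congr 1
    ext t
    rw [ENNReal.ofReal_pow (norm_nonneg _), ofReal_norm]
  · exact (hc.continuousOn.integrableOn_compact (isCompact_closedBall 0 1)).mono_set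
      ball_subset_closedBall
  · exact Filter.Eventually.of_forall fun t => by positivity

/-- A closed cube around `x` inside `B` carries the product inequality. The loss per degree is `s⁻¹
^ n`, which tends to `1` as `s` tends to `1`. -/
theorem exists_norm_eval_le_of_mem_ball {n : ℕ} {x : EuclideanSpace ℝ (Fin n)} (hx : x ∈ B n)
    {s : ℝ} (hs0 : 0 < s) (hs1 : s < 1) :
    ∃ C : ℝ, 0 ≤ C ∧ ∀ᶠ z in nhds (toComplex x), ∀ (m : ℕ) (A : MvPolynomial (Fin n) ℂ),
      A.totalDegree ≤ m → ‖MvPolynomial.eval z.ofLp A‖ ≤ C * (s⁻¹ ^ n) ^ m * ballNorm A := by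
  have hopen : IsOpen ((WithLp.toLp 2 : (Fin n → ℝ) → EuclideanSpace ℝ (Fin n)) ⁻¹' B n) :=
    isOpen_ball.preimage (PiLp.continuous_toLp 2 _)
  obtain ⟨δ, hδ, hsub⟩ := nhds_basis_closedBall.mem_iff.1
    (hopen.mem_nhds (x := x.ofLp) (by simpa using hx))
  have hr : 0 < δ * ((s⁻¹ - s) / 2) := by
    have := (one_lt_inv₀ hs0).2 hs1
    have : 0 < s⁻¹ - s := by linarith
    positivity
  have hW := walshConst_nonneg hs1
  set W := walshConst s * δ⁻¹
  have hW0 : 0 ≤ W := by positivity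
  refine ⟨Real.sqrt (W ^ n), Real.sqrt_nonneg _, ?_⟩
  have hnear : ∀ᶠ z : EuclideanSpace ℂ (Fin n) in nhds (toComplex x), ∀ i, ‖z.ofLp i - (x i : ℂ)‖ ≤ δ * ((s⁻¹ - s) / 2) := by
    refine Filter.eventually_all.2 fun i => ?_
    have hc : Continuous fun z : EuclideanSpace ℂ (Fin n) => ‖z.ofLp i - (x i : ℂ)‖ := by fun_prop
    have h0 : ‖(toComplex x).ofLp i - (x i : ℂ)‖ < δ * ((s⁻¹ - s) / 2) := by
      simpa [toComplex] using hr
    exact (hc.continuousAt.eventually (gt_mem_nhds h0)).mono fun _ h => h.le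
  filter_upwards [hnear] with z hz m A hA
  have h := enorm_sq_eval_le_lintegral_pi hs0 hs1 hA hδ z.ofLp hz
  have hvol : ∫⁻ t in Set.univ.pi fun i => Set.Icc (x i - δ) (x i + δ),
      ‖MvPolynomial.eval (fun i => (t i : ℂ)) A‖ₑ ^ 2 ≤ ENNReal.ofReal (ballNorm A ^ 2) := by
    rw [ofReal_ballNorm_sq]
    have hset : (Set.univ.pi fun i => Set.Icc (x i - δ) (x i + δ)) ⊆
        (WithLp.toLp 2 : (Fin n → ℝ) → EuclideanSpace ℝ (Fin n)) ⁻¹' B n := by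
      simp only [← Real.closedBall_eq_Icc]
      rw [← closedBall_pi _ hδ.le]
      exact hsub
    refine (lintegral_mono_set hset).trans_eq ?_
    have hmp := (EuclideanSpace.volume_preserving_symm_measurableEquiv_toLp (Fin n)).symm
    exact hmp.setLIntegral_comp_preimage_emb (MeasurableEquiv.measurableEmbedding _)
      (fun y => ‖MvPolynomial.eval (toComplex y).ofLp A‖ₑ ^ 2) (B n)
  have h2 := h.trans (mul_le_mul_right hvol _)
  have hs0' := inv_pos.2 hs0
  have hK : 0 ≤ walshConst s * s⁻¹ ^ (2 * m) * δ⁻¹ := by positivity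
  rw [← ENNReal.ofReal_pow hK, ← ENNReal.ofReal_mul (by positivity), ← ofReal_norm,
    ← ENNReal.ofReal_pow (norm_nonneg _), ENNReal.ofReal_le_ofReal_iff (by positivity)] at h2
  refine (Real.le_sqrt_of_sq_le h2).trans_eq ?_
  have : (walshConst s * s⁻¹ ^ (2 * m) * δ⁻¹) ^ n * ballNorm A ^ 2 =
      W ^ n * ((s⁻¹ ^ n) ^ m * ballNorm A) ^ 2 := by
    simp only [W, mul_pow, ← pow_mul]
    ring
  rw [this, Real.sqrt_mul (by positivity), Real.sqrt_sq (mul_nonneg (by positivity)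
    (ballNorm_nonneg A)), mul_assoc]

theorem toComplex_smul {n : ℕ} (c : ℝ) (x : EuclideanSpace ℝ (Fin n)) :
    toComplex (c • x) = (c : ℂ) • toComplex x := by
  ext j; simp [toComplex]

/-- Homogeneous polynomials decay geometrically near the points of the rotated balls. -/
theorem exists_norm_eval_le {n : ℕ} {z₀ : EuclideanSpace ℂ (Fin n)} (hz₀ : z₀ ∈ allRotations n) :
    ∃ C ρ : ℝ, 0 ≤ C ∧ 0 ≤ ρ ∧ ρ < 1 ∧ ∀ᶠ z in nhds z₀, ∀ (m : ℕ) (A : MvPolynomial (Fin n) ℂ),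
      A.IsHomogeneous m → ‖MvPolynomial.eval z.ofLp A‖ ≤ C * ρ ^ m * ballNorm A := by
  obtain ⟨ψ, x, hx, rfl⟩ := hz₀
  have hx1 : ‖x‖ < 1 := by simpa using hx
  -- The point `σ⁻¹ x` is still in `B`. Scaling back by `σ` gains `σ ^ m`, which beats the loss
  -- `(s⁻¹ ^ n) ^ m` for `s` close to `1`; the rotation contributes only a unimodular factor.
  obtain ⟨σ, hσ, hσ1⟩ := exists_between hx1
  have hσ0 : 0 < σ := (norm_nonneg x).trans_lt hσ
  have hlim : Filter.Tendsto (fun s : ℝ => σ * s⁻¹ ^ n) (nhdsWithin 1 (Set.Iio 1)) (nhds σ) := by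
    have : ContinuousAt (fun s : ℝ => σ * s⁻¹ ^ n) 1 := by
      fun_prop (disch := norm_num)
    have h := this.tendsto
    simp only [inv_one, one_pow, mul_one] at h
    exact h.mono_left nhdsWithin_le_nhds
  obtain ⟨s, hsρ, hs0, hs1⟩ := ((hlim.eventually (gt_mem_nhds hσ1)).and
    (Ioo_mem_nhdsLT (show (0 : ℝ) < 1 by norm_num))).exists
  have hy : σ⁻¹ • x ∈ B n := by
    simp only [mem_ball, dist_zero_right, norm_smul, norm_inv, Real.norm_eq_abs, abs_of_pos hσ0]
    rw [inv_mul_lt_iff₀ hσ0]; linarith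
  obtain ⟨C, hC, hev⟩ := exists_norm_eval_le_of_mem_ball hy hs0 hs1
  refine ⟨C, σ * s⁻¹ ^ n, hC, by have := inv_pos.2 hs0; positivity, hsρ, ?_⟩
  set e : ℂ := Complex.exp (ψ * Complex.I)
  have he : ‖e‖ = 1 := Complex.norm_exp_ofReal_mul_I ψ
  have he0 : e ≠ 0 := Complex.exp_ne_zero _
  have hσc : (σ : ℂ) ≠ 0 := by exact_mod_cast hσ0.ne'
  have htend : Filter.Tendsto (fun z : EuclideanSpace ℂ (Fin n) => (e * σ)⁻¹ • z)
      (nhds (rotate ψ x)) (nhds (toComplex (σ⁻¹ • x))) := by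
    have : toComplex (σ⁻¹ • x) = (e * σ)⁻¹ • rotate ψ x := by
      rw [toComplex_smul, rotate, smul_smul]
      congr 1
      push_cast
      field_simp
      rfl
    rw [this]
    exact (continuous_const_smul _).tendsto _
  filter_upwards [htend.eventually hev] with z hz m A hA
  have h := hz m A hA.totalDegree_le
  have hz' : z.ofLp = (e * σ) • ((e * σ)⁻¹ • z).ofLp := by
    rw [← WithLp.ofLp_smul, smul_smul, mul_inv_cancel₀ (mul_ne_zero he0 hσc), one_smul]
  rw [hz', eval_smul_of_isHomogeneous hA, norm_mul, norm_pow, norm_mul, he, one_mul,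
    Complex.norm_real, Real.norm_of_nonneg hσ0.le]
  calc σ ^ m * ‖MvPolynomial.eval ((e * σ)⁻¹ • z).ofLp A‖
      ≤ σ ^ m * (C * (s⁻¹ ^ n) ^ m * ballNorm A) := by gcongr
    _ = _ := by rw [mul_pow]; ring

/-! ### Taylor series and Weierstrass's theorem in several complex variables -/

theorem exists_ball_tendstoUniformlyOn {E F : Type*} [NormedAddCommGroup E] [ProperSpace E]
    [NormedAddCommGroup F] {f : ℕ → E → F} {g : E → F} {U : Set E}
    (hU : IsOpen U) (hfg : TendstoLocallyUniformlyOn f g Filter.atTop U) {c : E} (hc : c ∈ U) :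
    ∃ R > 0, closedBall c R ⊆ U ∧ TendstoUniformlyOn f g Filter.atTop (closedBall c R) := by
  obtain ⟨R, hR, hRU⟩ := nhds_basis_closedBall.mem_iff.1 (hU.mem_nhds hc)
  exact ⟨R, hR, hRU, (tendstoLocallyUniformlyOn_iff_forall_isCompact hU).1 hfg _ hRU
    (isCompact_closedBall c R)⟩

section Analytic

universe u

variable {E F : Type u} [NormedAddCommGroup E] [NormedSpace ℂ E]
  [NormedAddCommGroup F] [NormedSpace ℂ F]

/-- The factor `2` appears because the estimate is centred at `f c`, and values of norm at most `M`
lie within `2 * M` of `f c`. -/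
theorem norm_fderiv_le_of_forall_mem_ball {f : E → F} {c : E} {R M : ℝ} (hR : 0 < R)
    (hf : DifferentiableOn ℂ f (ball c R)) (hM : ∀ z ∈ ball c R, ‖f z‖ ≤ M) :
    ‖fderiv ℂ f c‖ ≤ 2 * M / R := by
  refine Complex.norm_fderiv_le_div_of_mapsTo_ball hf (fun z hz => ?_) hR
  rw [mem_closedBall, dist_eq_norm]
  linarith [norm_sub_le (f z) (f c), hM z hz, hM c (mem_ball_self hR)]

/-- The Taylor series of a function at a point. -/
noncomputable def taylorAt (f : E → F) (c : E) : FormalMultilinearSeries ℂ E F :=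
  fun k => ((k.factorial : ℂ)⁻¹) • iteratedFDeriv ℂ k f c

/-- Each derivative costs one layer of width `r` of the ball. The induction replaces `F` by `E →L[ℂ]
F`, so the target space is quantified inside the statement and shares the universe of `E`. -/
theorem norm_iteratedFDeriv_le_of_forall_mem_ball (k : ℕ) {r : ℝ} (hr : 0 < r) :
    ∀ {F : Type u} [NormedAddCommGroup F] [NormedSpace ℂ F] [CompleteSpace F]
      {f : E → F} {c : E} {M : ℝ},
      AnalyticOnNhd ℂ f (ball c ((k + 1) * r)) → (∀ z ∈ ball c ((k + 1) * r), ‖f z‖ ≤ M) →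
      ‖iteratedFDeriv ℂ k f c‖ ≤ M * (2 / r) ^ k := by
  induction k with
  | zero =>
    intro F _ _ _ f c M _ hM
    simpa using hM c (mem_ball_self (by positivity))
  | succ k ih =>
    intro F _ _ _ f c M hf hM
    have hsub : ∀ z ∈ ball c ((k + 1) * r), ball z r ⊆ ball c ((k + 1 + 1) * r) := by
      intro z hz
      refine ball_subset_ball' ?_
      have := mem_ball.1 hz
      linarith
    push_cast at hf hM
    have hsub' : ball c ((k + 1) * r) ⊆ ball c ((k + 1 + 1) * r) :=
      ball_subset_ball (by linarith)
    have h := ih (f := fderiv ℂ f) (c := c) (M := 2 * M / r)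
      (fun z hz => (hf z (hsub' hz)).fderiv) fun z hz =>
        norm_fderiv_le_of_forall_mem_ball hr
          (fun w hw => (hf w (hsub z hz hw)).differentiableAt.differentiableWithinAt)
          fun w hw => hM w (hsub z hz hw)
    rw [norm_iteratedFDeriv_fderiv] at h
    refine h.trans_eq ?_
    ring

/-- Layers of width `R / (k + 1)` give the factor `(k + 1) ^ k / k!`, which is at most `exp (k +
1)`; the bound is therefore geometric in `k`. -/
theorem norm_taylorAt_le [CompleteSpace F] {f : E → F} {c : E} {R M : ℝ} (hR : 0 < R)
    (hf : AnalyticOnNhd ℂ f (ball c R)) (hM : ∀ z ∈ ball c R, ‖f z‖ ≤ M) (k : ℕ) :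
    ‖taylorAt f c k‖ ≤ M * Real.exp 1 * (2 * Real.exp 1 / R) ^ k := by
  have hM0 : 0 ≤ M := (norm_nonneg _).trans (hM c (mem_ball_self hR))
  have hk : ((k : ℝ) + 1) * (R / (k + 1)) = R := by field_simp
  have h := norm_iteratedFDeriv_le_of_forall_mem_ball k (r := R / (k + 1)) (by positivity)
    (f := f) (c := c) (M := M) (by rwa [hk]) (by rwa [hk])
  have hfac : (0 : ℝ) < k.factorial := by exact_mod_cast k.factorial_pos
  rw [taylorAt, norm_smul, norm_inv, Complex.norm_natCast]
  have he : ((k : ℝ) + 1) ^ k / k.factorial ≤ Real.exp 1 * Real.exp 1 ^ k := by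
    have h2 := Real.pow_div_factorial_le_exp (k + 1) (by positivity) (k + 1)
    rw [Nat.factorial_succ, pow_succ] at h2
    push_cast at h2
    rw [mul_comm ((k : ℝ) + 1) (k.factorial : ℝ), mul_div_mul_right _ _ (by positivity)] at h2
    refine h2.trans_eq ?_
    rw [← Real.exp_nat_mul, ← Real.exp_add]
    congr 1; ring
  calc (k.factorial : ℝ)⁻¹ * ‖iteratedFDeriv ℂ k f c‖
      ≤ (k.factorial : ℝ)⁻¹ * (M * (2 / (R / (k + 1))) ^ k) := by gcongr
    _ = M * (2 / R) ^ k * (((k : ℝ) + 1) ^ k / k.factorial) := by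
        rw [div_div_eq_mul_div, mul_div_right_comm, mul_pow]; field_simp
    _ ≤ M * (2 / R) ^ k * (Real.exp 1 * Real.exp 1 ^ k) := by gcongr
    _ = _ := by rw [mul_div_right_comm, mul_pow]; ring

theorem taylorAt_apply_smul (f : E → F) (c h : E) (l : ℂ) (k : ℕ) :
    taylorAt f c k (fun _ => l • h) = l ^ k • taylorAt f c k fun _ => h := by
  rw [ContinuousMultilinearMap.map_smul_univ]
  simp

theorem _root_.AnalyticAt.hasSum_taylorAt [CompleteSpace F] {f : E → F} {c : E}
    (hf : AnalyticAt ℂ f c) :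
    ∀ᶠ h in nhds (0 : E), HasSum (fun k => taylorAt f c k fun _ => h) (f (c + h)) := by
  obtain ⟨p, r, hp⟩ := hf
  filter_upwards [eball_mem_nhds (0 : E) hp.r_pos] with h hh
  exact hp.hasSum_iteratedFDeriv hh

/-- Both sides are coefficients of power series of the one-variable slice at `0`, and these are
unique. -/
theorem cauchyPowerSeries_slice [CompleteSpace F] {f : E → F} {c h : E} (hf : AnalyticAt ℂ f c)
    {R : NNReal} (hR : 0 < R)
    (hd : DifferentiableOn ℂ (fun l : ℂ => f (c + l • h)) (closedBall 0 R)) (k : ℕ) :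
    (cauchyPowerSeries (fun l : ℂ => f (c + l • h)) 0 R).coeff k = taylorAt f c k fun _ => h := by
  set p : FormalMultilinearSeries ℂ ℂ F := fun k =>
    ContinuousMultilinearMap.mkPiRing ℂ (Fin k) (taylorAt f c k fun _ => h)
  have hpc : ∀ k, p.coeff k = taylorAt f c k fun _ => h := fun k => by
    simp [p, FormalMultilinearSeries.coeff]
  have hp : HasFPowerSeriesAt (fun l : ℂ => f (c + l • h)) p 0 := by
    rw [hasFPowerSeriesAt_iff]
    have ht : Filter.Tendsto (fun l : ℂ => l • h) (nhds 0) (nhds 0) := by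
      have : Continuous fun l : ℂ => l • h := by fun_prop
      simpa using this.tendsto 0
    filter_upwards [ht.eventually hf.hasSum_taylorAt] with l hl
    simp only [hpc, zero_add]
    simpa only [taylorAt_apply_smul] using hl
  rw [((hd.hasFPowerSeriesOnBall hR).hasFPowerSeriesAt).eq_formalMultilinearSeries hp, hpc]

/-- Convergence at `c + h` needs holomorphy only on a disc of the complex line through `c` and `c +
h`, not on a ball of `E`. This is what makes expansions at `0` usable on the rotated balls. -/
theorem hasSum_taylorAt_of_slice [CompleteSpace F] {f : E → F} {c h : E} (hf : AnalyticAt ℂ f c)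
    {R : ℝ} (hR : 1 < R)
    (hd : DifferentiableOn ℂ (fun l : ℂ => f (c + l • h)) (closedBall 0 R)) :
    HasSum (fun k => taylorAt f c k fun _ => h) (f (c + h)) := by
  lift R to NNReal using by linarith
  have hR0 : 0 < R := by
    have : (0 : ℝ) < R := by linarith
    exact_mod_cast this
  have h1 := (hd.hasFPowerSeriesOnBall hR0).hasSum (y := (1 : ℂ)) (by
    simp only [mem_eball, edist_zero_right, enorm_one]
    exact_mod_cast hR)
  simp only [zero_add, one_smul] at h1
  convert h1 using 2 with k
  rw [← cauchyPowerSeries_slice hf hR0 hd k]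
  rfl

theorem norm_taylorAt_le_of_slice [CompleteSpace F] {f : E → F} {c h : E} (hf : AnalyticAt ℂ f c)
    (hd : DifferentiableOn ℂ (fun l : ℂ => f (c + l • h)) (closedBall 0 1)) {M : ℝ}
    (hM : ∀ l : ℂ, ‖l‖ = 1 → ‖f (c + l • h)‖ ≤ M) (k : ℕ) :
    ‖taylorAt f c k fun _ => h‖ ≤ M := by
  have hk := cauchyPowerSeries_slice hf (R := 1) one_pos (by simpa using hd) k
  rw [← hk, FormalMultilinearSeries.coeff]
  refine (ContinuousMultilinearMap.le_opNorm _ _).trans ?_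
  simp only [Pi.one_apply, norm_one, Finset.prod_const_one, mul_one]
  refine (norm_cauchyPowerSeries_le _ _ _ _).trans ?_
  simp only [NNReal.coe_one, abs_one, inv_one, one_pow, mul_one]
  have hpi := Real.pi_pos
  have hle : ∫ θ in (0 : ℝ)..2 * Real.pi, ‖f (c + circleMap 0 1 θ • h)‖ ≤
      ∫ θ in (0 : ℝ)..2 * Real.pi, M := by
    refine intervalIntegral.integral_mono_on (by positivity)
      (Continuous.intervalIntegrable ?_ _ _) (by simp) fun θ _ => hM _ (by simp)
    refine (ContinuousOn.comp_continuous hd.continuousOn (continuous_circleMap 0 1)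
      fun θ => ?_).norm
    simp
  rw [intervalIntegral.integral_const, smul_eq_mul, sub_zero] at hle
  calc _ ≤ (2 * Real.pi)⁻¹ * (2 * Real.pi * M) := by gcongr
    _ = M := by field_simp

theorem differentiableOn_slice {f : E → F} {c h : E} {R S : ℝ} (hf : DifferentiableOn ℂ f (ball c R))
    (hS : S * ‖h‖ < R) : DifferentiableOn ℂ (fun l : ℂ => f (c + l • h)) (closedBall 0 S) := by
  refine hf.comp (by fun_prop) fun l hl => ?_
  rw [mem_ball, dist_eq_norm, add_sub_cancel_left, norm_smul]
  have : ‖l‖ ≤ S := by simpa using hl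
  exact (mul_le_mul_of_nonneg_right this (norm_nonneg h)).trans_lt hS

/-- By the Cauchy estimates the Taylor coefficients of `f j` form Cauchy sequences with a common
geometric bound. Their limits define a power series, and dominated convergence identifies its sum
with `g`. -/
theorem analyticAt_of_tendstoUniformlyOn_of_bounded [CompleteSpace F] {f : ℕ → E → F} {g : E → F}
    {c : E} {R M : ℝ} (hR : 0 < R) (hf : ∀ j, AnalyticOnNhd ℂ (f j) (ball c R))
    (hM : ∀ j, ∀ z ∈ ball c R, ‖f j z‖ ≤ M)
    (hfg : TendstoUniformlyOn f g Filter.atTop (ball c R)) : AnalyticAt ℂ g c := by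
  set D := 2 * Real.exp 1 / R
  have hD : 0 < D := by positivity
  have he := Real.exp_pos 1
  have hM0 : 0 ≤ M := (norm_nonneg _).trans (hM 0 c (mem_ball_self hR))
  have hcau : ∀ k, CauchySeq fun j => taylorAt (f j) c k := by
    intro k
    rw [Metric.cauchySeq_iff]
    intro ε hε
    -- Two functions within `η` of `g` differ by at most `2 * η`, and the coefficient bound turns
    -- this into `ε / 2`.
    set η := ε / (4 * (Real.exp 1 * D ^ k))
    have hη : 0 < η := by positivity
    obtain ⟨N, hN⟩ := Filter.eventually_atTop.1 (Metric.tendstoUniformlyOn_iff.1 hfg η hη)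
    refine ⟨N, fun i hi j hj => ?_⟩
    have h := norm_taylorAt_le (f := f i - f j) (c := c) hR ((hf i).sub (hf j)) (M := 2 * η)
      (fun z hz => by
        have h1 := hN i hi z hz
        have h2 := hN j hj z hz
        rw [Pi.sub_apply, ← dist_eq_norm]
        linarith [dist_triangle_left (f i z) (f j z) (g z)]) k
    have hsub : taylorAt (f i - f j) c k = taylorAt (f i) c k - taylorAt (f j) c k := by
      rw [taylorAt, taylorAt, taylorAt, ← smul_sub, iteratedFDeriv_sub_apply]
      · exact (hf i c (mem_ball_self hR)).contDiffAt
      · exact (hf j c (mem_ball_self hR)).contDiffAt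
    rw [hsub] at h
    rw [dist_eq_norm]
    refine h.trans_lt ?_
    have : 2 * η * Real.exp 1 * D ^ k = ε / 2 := by
      simp only [η]; field_simp; ring
    rw [this]; linarith
  choose a ha using fun k => cauchySeq_tendsto_of_complete (hcau k)
  have hab : ∀ k, ‖a k‖ ≤ M * Real.exp 1 * D ^ k := fun k =>
    le_of_tendsto (ha k).norm (Filter.Eventually.of_forall fun j =>
      norm_taylorAt_le hR (hf j) (hM j) k)
  -- With this radius `D * r = 1 / 2`, so the terms are dominated by a geometric series of ratio `1
  -- / 2`.
  set r : ℝ := R / (4 * Real.exp 1) with hrdef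
  have hr : 0 < r := by positivity
  have hrR : 2 * r < R := by
    have := Real.add_one_le_exp (1 : ℝ)
    rw [hrdef, mul_div_assoc', div_lt_iff₀ (by positivity)]
    nlinarith
  have hDr : D * r = 1 / 2 := by simp only [D, r]; field_simp; ring
  refine ⟨a, ENNReal.ofReal r, ?_, by simpa using hr, fun {h} hh => ?_⟩
  · refine FormalMultilinearSeries.le_radius_of_bound (r := r.toNNReal) (C := M * Real.exp 1) _
      fun k => ?_
    rw [Real.coe_toNNReal _ hr.le]
    calc ‖a k‖ * r ^ k ≤ M * Real.exp 1 * D ^ k * r ^ k := by gcongr; exact hab k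
      _ = M * Real.exp 1 * (1 / 2) ^ k := by rw [mul_assoc, ← mul_pow, hDr]
      _ ≤ M * Real.exp 1 * 1 := by
          gcongr
          exact pow_le_one₀ (by norm_num) (by norm_num)
      _ = _ := mul_one _
  · have hh' : ‖h‖ < r := by
      rw [mem_eball, edist_zero_right, ← ofReal_norm, ENNReal.ofReal_lt_ofReal_iff hr] at hh
      exact hh
    have happ : ∀ (k : ℕ) (T : ContinuousMultilinearMap ℂ (fun _ : Fin k => E) F),
        ‖T‖ ≤ M * Real.exp 1 * D ^ k → ‖T fun _ => h‖ ≤ M * Real.exp 1 * (1 / 2) ^ k := by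
      intro k T hT
      refine (T.le_opNorm _).trans ?_
      rw [Finset.prod_const, Finset.card_univ, Fintype.card_fin]
      calc ‖T‖ * ‖h‖ ^ k ≤ M * Real.exp 1 * D ^ k * r ^ k := by gcongr
        _ = _ := by rw [mul_assoc, ← mul_pow, hDr]
    have hsb : Summable fun k : ℕ => M * Real.exp 1 * (1 / 2 : ℝ) ^ k :=
      (summable_geometric_two).mul_left _
    have hsum : Summable fun k => a k fun _ => h :=
      Summable.of_norm_bounded hsb fun k => happ k _ (hab k)
    have hlim := tendsto_tsum_of_dominated_convergence (𝓕 := Filter.atTop) hsb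
      (f := fun j k => taylorAt (f j) c k fun _ => h) (g := fun k => a k fun _ => h)
      (fun k => ((ContinuousMultilinearMap.apply ℂ (fun _ : Fin k => E) F
        (fun _ => h)).continuous.tendsto _).comp (ha k))
      (Filter.Eventually.of_forall fun j k => happ k _ (norm_taylorAt_le hR (hf j) (hM j) k))
    have hts : ∀ j, ∑' k, (taylorAt (f j) c k fun _ => h) = f j (c + h) := fun j =>
      (hasSum_taylorAt_of_slice (hf j c (mem_ball_self hR)) (R := 2) (by norm_num)
        (differentiableOn_slice (hf j).differentiableOn (by linarith))).tsum_eq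
    simp only [hts] at hlim
    have hmem : c + h ∈ ball c R := by
      rw [mem_ball, dist_eq_norm, add_sub_cancel_left]; linarith
    rw [tendsto_nhds_unique (hfg.tendsto_at hmem) hlim]
    exact hsum.hasSum

/-- Locally uniform limits of analytic functions are analytic. -/
theorem _root_.TendstoLocallyUniformlyOn.analyticOnNhd [ProperSpace E] [CompleteSpace F]
    {f : ℕ → E → F} {g : E → F} {U : Set E} (hU : IsOpen U) (hf : ∀ j, AnalyticOnNhd ℂ (f j) U)
    (hfg : TendstoLocallyUniformlyOn f g Filter.atTop U) : AnalyticOnNhd ℂ g U := by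
  intro c hc
  obtain ⟨R, hR, hRU, hunif⟩ := exists_ball_tendstoUniformlyOn hU hfg hc
  obtain ⟨N, hN⟩ := Filter.eventually_atTop.1 (Metric.tendstoUniformlyOn_iff.1 hunif 1 one_pos)
  obtain ⟨M, hM⟩ := (isCompact_closedBall c R).exists_bound_of_continuousOn
    ((hf N).continuousOn.mono hRU)
  -- From index `N` on, all functions are within `2` of `f N`, which is bounded by `M` on the
  -- compact ball.
  refine analyticAt_of_tendstoUniformlyOn_of_bounded (f := fun j => f (j + N)) (M := M + 2) hR
    (fun j z hz => hf _ z (hRU (ball_subset_closedBall hz))) (fun j z hz => ?_)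
    (fun u hu => ((Filter.tendsto_add_atTop_nat N).eventually (hunif u hu)).mono
      fun j hj z hz => hj z (ball_subset_closedBall hz))
  have hz' := ball_subset_closedBall hz
  have h1 := hN (j + N) (by omega) z hz'
  have h2 := hN N le_rfl z hz'
  have h3 := hM z hz'
  have h4 : dist (f (j + N) z) (f N z) < 2 := by
    linarith [dist_triangle_left (f (j + N) z) (f N z) (g z)]
  rw [dist_eq_norm] at h4
  linarith [norm_le_norm_add_norm_sub' (f (j + N) z) (f N z)]

/-- The Cauchy estimate for `g - f j` on balls of radius `R / 2` turns uniform smallness of the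
difference into uniform smallness of its derivative. -/
theorem _root_.TendstoLocallyUniformlyOn.fderiv_apply [ProperSpace E] [CompleteSpace F]
    {f : ℕ → E → F} {g : E → F} {U : Set E} (hU : IsOpen U) (hf : ∀ j, AnalyticOnNhd ℂ (f j) U)
    (hfg : TendstoLocallyUniformlyOn f g Filter.atTop U) (v : E) :
    TendstoLocallyUniformlyOn (fun j z => fderiv ℂ (f j) z v) (fun z => fderiv ℂ g z v)
      Filter.atTop U := by
  have hg := hfg.analyticOnNhd hU hf
  rw [tendstoLocallyUniformlyOn_iff]
  intro ε hε c hc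
  obtain ⟨R, hR, hRU, hunif⟩ := exists_ball_tendstoUniformlyOn hU hfg hc
  have hv : 0 < ‖v‖ + 1 := by positivity
  set η := ε * R / (8 * (‖v‖ + 1))
  have hη : 0 < η := by positivity
  refine ⟨ball c (R / 2), mem_nhdsWithin_of_mem_nhds (ball_mem_nhds c (by positivity)), ?_⟩
  filter_upwards [Metric.tendstoUniformlyOn_iff.1 hunif η hη] with j hj z hz
  have hsub : ball z (R / 2) ⊆ closedBall c R := by
    refine (ball_subset_ball' (ε₂ := R) ?_).trans ball_subset_closedBall
    have := mem_ball.1 hz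
    linarith
  have hzU : z ∈ U := hRU (hsub (mem_ball_self (by positivity)))
  have h := norm_fderiv_le_of_forall_mem_ball (f := g - f j) (c := z) (R := R / 2) (M := η)
    (by positivity)
    (fun w hw => ((hg w (hRU (hsub hw))).differentiableAt.sub
      (hf j w (hRU (hsub hw))).differentiableAt).differentiableWithinAt)
    (fun w hw => by
      rw [Pi.sub_apply, ← dist_eq_norm]
      exact (hj w (hsub hw)).le)
  rw [fderiv_sub (hg z hzU).differentiableAt (hf j z hzU).differentiableAt] at h
  rw [dist_eq_norm, ← _root_.sub_apply]
  calc ‖(fderiv ℂ g z - fderiv ℂ (f j) z) v‖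
      ≤ ‖fderiv ℂ g z - fderiv ℂ (f j) z‖ * ‖v‖ := ContinuousLinearMap.le_opNorm _ _
    _ ≤ (2 * η / (R / 2)) * (‖v‖ + 1) := by gcongr; linarith
    _ = ε / 2 := by simp only [η]; field_simp; ring
    _ < ε := by linarith

theorem _root_.AnalyticAt.fderiv_apply [CompleteSpace F] {f : E → F} {c : E}
    (hf : AnalyticAt ℂ f c) (v : E) : AnalyticAt ℂ (fun z => fderiv ℂ f z v) c :=
  ((ContinuousLinearMap.apply ℂ F v).analyticAt _).comp hf.fderiv

end Analytic

/-! ### The Laplacian as the restriction of a holomorphic operator -/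

section Laplacian

variable {n : ℕ}

/-- The holomorphic Laplacian `∑ ∂²/∂zᵢ²` on `ℂⁿ`. -/
noncomputable def holLaplacian (F : EuclideanSpace ℂ (Fin n) → ℂ) : EuclideanSpace ℂ (Fin n) → ℂ :=
  fun z => ∑ i, fderiv ℂ (fun w => fderiv ℂ F w (EuclideanSpace.single i 1)) z
    (EuclideanSpace.single i 1)

theorem _root_.AnalyticAt.holLaplacian {F : EuclideanSpace ℂ (Fin n) → ℂ}
    {z : EuclideanSpace ℂ (Fin n)} (hF : AnalyticAt ℂ F z) : AnalyticAt ℂ (holLaplacian F) z :=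
  Finset.analyticAt_fun_sum _ fun _ _ => (hF.fderiv_apply _).fderiv_apply _

theorem _root_.AnalyticAt.iterate_holLaplacian {F : EuclideanSpace ℂ (Fin n) → ℂ}
    {z : EuclideanSpace ℂ (Fin n)} (hF : AnalyticAt ℂ F z) (p : ℕ) :
    AnalyticAt ℂ (PolyBergman.holLaplacian^[p] F) z := by
  induction p with
  | zero => exact hF
  | succ p ih => rw [Function.iterate_succ_apply']; exact ih.holLaplacian

theorem tendstoLocallyUniformlyOn_fun_sum {α ι κ : Type*} [TopologicalSpace α] {l : Filter κ}
    {f : ι → κ → α → ℂ} {g : ι → α → ℂ} {U : Set α} (s : Finset ι)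
    (h : ∀ i ∈ s, TendstoLocallyUniformlyOn (f i) (g i) l U) :
    TendstoLocallyUniformlyOn (fun j z => ∑ i ∈ s, f i j z) (fun z => ∑ i ∈ s, g i z) l U := by
  classical
  induction s using Finset.induction_on with
  | empty =>
    simp only [Finset.sum_empty]
    exact (tendstoLocallyUniformlyOn_iff.2 fun ε hε x _ =>
      ⟨Set.univ, Filter.univ_mem, Filter.Eventually.of_forall fun _ _ _ => by simpa using hε⟩)
  | insert i s hi ih =>
    simp only [Finset.sum_insert hi]
    exact (h i (Finset.mem_insert_self i s)).add
      (ih fun j hj => h j (Finset.mem_insert_of_mem hj))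

theorem _root_.TendstoLocallyUniformlyOn.iterate_holLaplacian
    {f : ℕ → EuclideanSpace ℂ (Fin n) → ℂ} {g : EuclideanSpace ℂ (Fin n) → ℂ}
    {U : Set (EuclideanSpace ℂ (Fin n))} (hU : IsOpen U) (hf : ∀ j, AnalyticOnNhd ℂ (f j) U)
    (hfg : TendstoLocallyUniformlyOn f g Filter.atTop U) (p : ℕ) :
    TendstoLocallyUniformlyOn (fun j => PolyBergman.holLaplacian^[p] (f j))
      (PolyBergman.holLaplacian^[p] g) Filter.atTop U := by
  induction p with
  | zero => exact hfg
  | succ p ih =>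
    simp only [Function.iterate_succ_apply']
    refine tendstoLocallyUniformlyOn_fun_sum _ fun i _ => ?_
    refine TendstoLocallyUniformlyOn.fderiv_apply hU (fun j z hz => ?_)
      (TendstoLocallyUniformlyOn.fderiv_apply hU (fun j z hz => ?_) ih _) _
    · exact ((hf j z hz).iterate_holLaplacian p).fderiv_apply _
    · exact (hf j z hz).iterate_holLaplacian p

/-- The inclusion of `ℝⁿ` into `ℂⁿ` as a continuous real linear map. -/
noncomputable def toComplexL (n : ℕ) : EuclideanSpace ℝ (Fin n) →L[ℝ] EuclideanSpace ℂ (Fin n) where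
  toFun := toComplex
  map_add' x y := by ext j; simp [toComplex]
  map_smul' c x := by ext j; simp [toComplex]
  cont := continuous_toComplex

theorem fderiv_comp_toComplex {F : EuclideanSpace ℂ (Fin n) → ℂ} {x : EuclideanSpace ℝ (Fin n)}
    (hF : DifferentiableAt ℂ F (toComplex x)) (v : EuclideanSpace ℝ (Fin n)) :
    fderiv ℝ (fun y => F (toComplex y)) x v = fderiv ℂ F (toComplex x) (toComplex v) := by
  have h1 : HasFDerivAt F ((fderiv ℂ F (toComplex x)).restrictScalars ℝ) (toComplexL n x) :=
    hF.hasFDerivAt.restrictScalars ℝ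
  have h2 := h1.comp x (toComplexL n).hasFDerivAt
  exact DFunLike.congr_fun h2.fderiv v

theorem _root_.AnalyticAt.comp_toComplex {F : EuclideanSpace ℂ (Fin n) → ℂ}
    {x : EuclideanSpace ℝ (Fin n)} (hF : AnalyticAt ℂ F (toComplex x)) :
    AnalyticAt ℝ (fun y => F (toComplex y)) x :=
  (hF.restrictScalars (𝕜 := ℝ)).comp ((toComplexL n).analyticAt x)

/-- The inclusion of `ℝⁿ` is real linear and sends basis vectors to basis vectors, so real partial
derivatives of the restriction are restrictions of complex partial derivatives. -/
theorem laplacian_comp_toComplex {F : EuclideanSpace ℂ (Fin n) → ℂ} {x : EuclideanSpace ℝ (Fin n)}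
    (hF : AnalyticAt ℂ F (toComplex x)) :
    Laplacian.laplacian (fun y => F (toComplex y)) x = holLaplacian F (toComplex x) := by
  rw [InnerProductSpace.laplacian_eq_iteratedFDeriv_orthonormalBasis _
    (EuclideanSpace.basisFun (Fin n) ℝ)]
  refine Finset.sum_congr rfl fun i _ => ?_
  rw [iteratedFDeriv_two_apply]
  simp only [EuclideanSpace.basisFun_apply, Matrix.cons_val_zero, Matrix.cons_val_one]
  set v : EuclideanSpace ℝ (Fin n) := EuclideanSpace.single i 1
  have hv : toComplex v = EuclideanSpace.single i 1 := by
    ext j; by_cases h : j = i <;> simp [toComplex, v, h]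
  have hd : DifferentiableAt ℝ (fderiv ℝ fun y => F (toComplex y)) x :=
    hF.comp_toComplex.fderiv.differentiableAt
  have h1 : fderiv ℝ (fderiv ℝ fun y => F (toComplex y)) x v v =
      fderiv ℝ (fun y => fderiv ℝ (fun y => F (toComplex y)) y v) x v := by
    rw [fderiv_clm_apply hd (differentiableAt_const v)]
    simp
  have h2 : (fun y => fderiv ℝ (fun y => F (toComplex y)) y v) =ᶠ[nhds x]
      fun y => (fun z => fderiv ℂ F z (EuclideanSpace.single i 1)) (toComplex y) := by
    filter_upwards [continuous_toComplex.continuousAt.eventually hF.eventually_analyticAt] with y hy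
    rw [fderiv_comp_toComplex hy.differentiableAt, hv]
  rw [h1, h2.fderiv_eq, fderiv_comp_toComplex (hF.fderiv_apply _).differentiableAt, hv]

theorem iterate_laplacian_comp_toComplex {F : EuclideanSpace ℂ (Fin n) → ℂ}
    {x : EuclideanSpace ℝ (Fin n)} (hF : AnalyticAt ℂ F (toComplex x)) (p : ℕ) :
    (Laplacian.laplacian^[p] fun y => F (toComplex y)) x = holLaplacian^[p] F (toComplex x) := by
  -- The induction runs on a neighbourhood, because the next Laplacian depends on the germ and not
  -- only on the value.
  have key : ∀ᶠ y in nhds x,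
      (Laplacian.laplacian^[p] fun y => F (toComplex y)) y = holLaplacian^[p] F (toComplex y) := by
    induction p with
    | zero => exact Filter.Eventually.of_forall fun _ => rfl
    | succ p ih =>
      simp only [Function.iterate_succ_apply']
      filter_upwards [ih.eventually_nhds,
        continuous_toComplex.continuousAt.eventually hF.eventually_analyticAt] with y hy hy2
      have h : (Laplacian.laplacian^[p] fun y => F (toComplex y)) =ᶠ[nhds y]
        fun y => holLaplacian^[p] F (toComplex y) := hy
      rw [(InnerProductSpace.laplacian_congr_nhds h).eq_of_nhds,
        laplacian_comp_toComplex (hy2.iterate_holLaplacian p)]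
  exact key.self_of_nhds

end Laplacian

/-! ### Orthogonality on spheres of homogeneous polyharmonic polynomials -/

section Orthogonality

variable {n : ℕ}

theorem hasFDerivAt_eval_ofLp (A : MvPolynomial (Fin n) ℂ) (z : EuclideanSpace ℂ (Fin n)) :
    ∃ L : EuclideanSpace ℂ (Fin n) →L[ℂ] ℂ,
      HasFDerivAt (fun z : EuclideanSpace ℂ (Fin n) => MvPolynomial.eval z.ofLp A) L z ∧
      ∀ i, L (EuclideanSpace.single i 1) = MvPolynomial.eval z.ofLp (MvPolynomial.pderiv i A) := by
  induction A using MvPolynomial.induction_on with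
  | C a =>
    refine ⟨0, ?_, fun i => by simp⟩
    simp only [MvPolynomial.eval_C]
    exact hasFDerivAt_const a z
  | add A A' h h' =>
    obtain ⟨L, hL, hi⟩ := h
    obtain ⟨L', hL', hi'⟩ := h'
    refine ⟨L + L', ?_, fun i => by simp [hi, hi']⟩
    simp only [map_add]
    exact hL.add hL'
  | mul_X A j h =>
    obtain ⟨L, hL, hi⟩ := h
    have hj : HasFDerivAt (fun z : EuclideanSpace ℂ (Fin n) => z.ofLp j)
        (EuclideanSpace.proj j : EuclideanSpace ℂ (Fin n) →L[ℂ] ℂ) z :=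
      (EuclideanSpace.proj j : EuclideanSpace ℂ (Fin n) →L[ℂ] ℂ).hasFDerivAt
    refine ⟨MvPolynomial.eval z.ofLp A • (EuclideanSpace.proj j : EuclideanSpace ℂ (Fin n) →L[ℂ] ℂ) +
      z.ofLp j • L, ?_, fun i => ?_⟩
    · simp only [map_mul, MvPolynomial.eval_X]
      exact hL.mul hj
    · by_cases h : j = i
      · subst h
        simp [hi]
      · have : i ≠ j := fun h' => h h'.symm
        simp [hi, MvPolynomial.pderiv_X_of_ne h, h]

theorem fderiv_eval_ofLp (A : MvPolynomial (Fin n) ℂ) (z : EuclideanSpace ℂ (Fin n)) (i : Fin n) :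
    fderiv ℂ (fun z : EuclideanSpace ℂ (Fin n) => MvPolynomial.eval z.ofLp A) z
      (EuclideanSpace.single i 1) = MvPolynomial.eval z.ofLp (MvPolynomial.pderiv i A) := by
  obtain ⟨L, hL, hi⟩ := hasFDerivAt_eval_ofLp A z
  rw [hL.fderiv, hi]

theorem analyticAt_eval_ofLp (A : MvPolynomial (Fin n) ℂ) (z : EuclideanSpace ℂ (Fin n)) :
    AnalyticAt ℂ (fun z : EuclideanSpace ℂ (Fin n) => MvPolynomial.eval z.ofLp A) z := by
  have := AnalyticAt.aeval_mvPolynomial (𝕜 := ℂ) (f := fun z : EuclideanSpace ℂ (Fin n) => z.ofLp)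
    (z := z) (fun i =>
      (EuclideanSpace.proj i : EuclideanSpace ℂ (Fin n) →L[ℂ] ℂ).analyticAt z) A
  exact this

/-- The Laplacian of a polynomial. -/
noncomputable def polyLaplacian (A : MvPolynomial (Fin n) ℂ) : MvPolynomial (Fin n) ℂ :=
  ∑ i, MvPolynomial.pderiv i (MvPolynomial.pderiv i A)

theorem polyLaplacian_zero : polyLaplacian (0 : MvPolynomial (Fin n) ℂ) = 0 := by
  simp [polyLaplacian]

theorem holLaplacian_eval (A : MvPolynomial (Fin n) ℂ) :
    holLaplacian (fun z => MvPolynomial.eval z.ofLp A) =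
      fun z => MvPolynomial.eval z.ofLp (polyLaplacian A) := by
  ext z
  simp only [holLaplacian, polyLaplacian, fderiv_eval_ofLp, map_sum]

theorem polyLaplacian_eq_zero_of_lt {A : MvPolynomial (Fin n) ℂ} {m : ℕ} (hA : A.IsHomogeneous m)
    (hm : m < 2) : polyLaplacian A = 0 := by
  refine Finset.sum_eq_zero fun i _ => ?_
  have h : (MvPolynomial.pderiv i A).IsHomogeneous 0 := by
    have := hA.pderiv (i := i)
    rwa [show m - 1 = 0 by omega] at this
  have h0 : (MvPolynomial.pderiv i A).totalDegree = 0 := Nat.le_zero.1 h.totalDegree_le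
  rw [MvPolynomial.totalDegree_eq_zero_iff_eq_C.1 h0, MvPolynomial.pderiv_C]

theorem isHomogeneous_polyLaplacian {A : MvPolynomial (Fin n) ℂ} {m : ℕ}
    (hA : A.IsHomogeneous m) : (polyLaplacian A).IsHomogeneous (m - 2) :=
  MvPolynomial.IsHomogeneous.sum _ _ _ fun i _ => by
    have := (hA.pderiv (i := i)).pderiv (i := i)
    rwa [Nat.sub_sub] at this

/-- The square makes the truncated weight differentiable across the unit sphere, so integration by
parts produces no boundary term. -/
theorem hasDerivAt_max_zero_sq (t : ℝ) : HasDerivAt (fun t : ℝ => max 0 t ^ 2) (2 * max 0 t) t := by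
  rcases lt_trichotomy t 0 with h | h | h
  · rw [max_eq_left h.le, mul_zero]
    refine (hasDerivAt_const t (0 : ℝ)).congr_of_eventuallyEq ?_
    filter_upwards [gt_mem_nhds h] with s hs
    simp [max_eq_left hs.le]
  · subst h
    rw [max_self, mul_zero]
    have h : (fun t : ℝ => max 0 t ^ 2) =O[nhds 0] fun t => ‖t - 0‖ ^ 2 := by
      refine Asymptotics.IsBigO.of_bound 1 (Filter.Eventually.of_forall fun s => ?_)
      simp only [sub_zero, norm_pow, norm_norm, one_mul]
      gcongr
      rw [Real.norm_eq_abs, Real.norm_eq_abs, abs_of_nonneg (le_max_left 0 s)]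
      exact max_le (abs_nonneg s) (le_abs_self s)
    have h2 := h.hasFDerivAt (𝕜 := ℝ) (by norm_num)
    simpa using h2.hasDerivAt
  · rw [max_eq_right h.le]
    have := (hasDerivAt_pow 2 t)
    simp only [Nat.cast_ofNat, Nat.add_one_sub_one, pow_one] at this
    refine this.congr_of_eventuallyEq ?_
    filter_upwards [lt_mem_nhds h] with s hs
    simp [max_eq_right hs.le]

/-- The weight `max (0, 1 - |x|²)ᵏ` as a function of `|x|`. -/
noncomputable def radialWeight (k : ℕ) (t : ℝ) : ℝ := max 0 (1 - t ^ 2) ^ k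

theorem continuous_radialWeight (k : ℕ) : Continuous (radialWeight k) := by
  unfold radialWeight; fun_prop

theorem radialWeight_eq_zero {k : ℕ} (hk : k ≠ 0) {t : ℝ} (ht : 1 ≤ t) : radialWeight k t = 0 := by
  rw [radialWeight, max_eq_left (by nlinarith), zero_pow hk]

theorem integrable_mul_radialWeight {k : ℕ} (hk : k ≠ 0) {f : EuclideanSpace ℝ (Fin n) → ℂ}
    (hf : Continuous f) : Integrable fun x => f x * (radialWeight k ‖x‖ : ℂ) := by
  refine Continuous.integrable_of_hasCompactSupport ?_ ?_
  · have := continuous_radialWeight k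
    fun_prop
  · refine HasCompactSupport.intro (isCompact_closedBall 0 1) fun x hx => ?_
    rw [radialWeight_eq_zero hk]
    · simp
    · simpa using (not_le.1 (by simpa using hx)).le

theorem continuous_eval_toComplex (A : MvPolynomial (Fin n) ℂ) :
    Continuous fun x => MvPolynomial.eval (toComplex x).ofLp A :=
  (continuous_eval_ofLp A).comp continuous_toComplex

/-- The integral of a polynomial against a radial weight. -/
noncomputable def weightIntegral (k : ℕ) (A : MvPolynomial (Fin n) ℂ) : ℂ :=
  ∫ x : EuclideanSpace ℝ (Fin n),
    MvPolynomial.eval (toComplex x).ofLp A * (radialWeight k ‖x‖ : ℂ)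

theorem weightIntegral_add {k : ℕ} (hk : k ≠ 0) (A A' : MvPolynomial (Fin n) ℂ) :
    weightIntegral k (A + A') = weightIntegral k A + weightIntegral k A' := by
  simp only [weightIntegral, map_add, add_mul]
  exact integral_add (integrable_mul_radialWeight hk (continuous_eval_toComplex A))
    (integrable_mul_radialWeight hk (continuous_eval_toComplex A'))

theorem weightIntegral_C_mul (k : ℕ) (c : ℂ) (A : MvPolynomial (Fin n) ℂ) :
    weightIntegral k (MvPolynomial.C c * A) = c * weightIntegral k A := by
  simp only [weightIntegral, map_mul, MvPolynomial.eval_C, mul_assoc]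
  exact integral_const_mul _ _

theorem weightIntegral_sum {k : ℕ} (hk : k ≠ 0) {ι : Type*} (s : Finset ι)
    (A : ι → MvPolynomial (Fin n) ℂ) :
    weightIntegral k (∑ i ∈ s, A i) = ∑ i ∈ s, weightIntegral k (A i) := by
  simp only [weightIntegral, map_sum, Finset.sum_mul]
  exact integral_finsetSum _ fun i _ =>
    integrable_mul_radialWeight hk (continuous_eval_toComplex (A i))

theorem toComplex_single (i : Fin n) :
    toComplex (EuclideanSpace.single i (1 : ℝ)) = EuclideanSpace.single i 1 := by
  ext j; by_cases h : j = i <;> simp [toComplex, h]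

/-- Integration by parts, using that the derivative of `max (0, 1 - |x|²)²` in the direction `i` is
`-4 xᵢ max (0, 1 - |x|²)`. -/
theorem weightIntegral_pderiv (A : MvPolynomial (Fin n) ℂ) (i : Fin n) :
    weightIntegral 2 (MvPolynomial.pderiv i A) =
      4 * weightIntegral 1 (MvPolynomial.X i * A) := by
  set v : EuclideanSpace ℝ (Fin n) := EuclideanSpace.single i 1
  set w : EuclideanSpace ℝ (Fin n) → ℂ := fun x => (radialWeight 2 ‖x‖ : ℂ)
  set f : EuclideanSpace ℝ (Fin n) → ℂ := fun x => MvPolynomial.eval (toComplex x).ofLp A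
  have hfd : Differentiable ℝ f := fun x => (analyticAt_eval_ofLp A _).comp_toComplex.differentiableAt
  have hf' : ∀ x, fderiv ℝ f x v =
      MvPolynomial.eval (toComplex x).ofLp (MvPolynomial.pderiv i A) := fun x => by
    rw [fderiv_comp_toComplex (analyticAt_eval_ofLp A _).differentiableAt, toComplex_single,
      fderiv_eval_ofLp]
  have hw : ∀ x, HasFDerivAt w (Complex.ofRealCLM.comp
      ((2 * max 0 (1 - ‖x‖ ^ 2)) • -(2 • innerSL ℝ x))) x := fun x => by
    have h1 : HasFDerivAt (fun x : EuclideanSpace ℝ (Fin n) => 1 - ‖x‖ ^ 2)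
        (-(2 • innerSL ℝ x)) x := ((hasStrictFDerivAt_norm_sq x).hasFDerivAt).const_sub 1
    have h2 := (hasDerivAt_max_zero_sq (1 - ‖x‖ ^ 2)).comp_hasFDerivAt x h1
    exact Complex.ofRealCLM.hasFDerivAt.comp x h2
  have hw' : ∀ x, fderiv ℝ w x v = -4 * ((x i : ℂ) * (radialWeight 1 ‖x‖ : ℂ)) := fun x => by
    rw [(hw x).fderiv]
    have : inner ℝ x v = x i := by
      simp [v, EuclideanSpace.inner_single_right]
    simp [this, radialWeight]
    ring
  have key := integral_mul_fderiv_eq_neg_fderiv_mul_of_integrable (μ := volume) (f := w) (g := f)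
    (v := v) ?_ ?_ ?_ (fun x _ => (hw x).differentiableAt) (fun x _ => hfd x)
  · simp only [hf', hw'] at key
    rw [weightIntegral, weightIntegral, ← integral_const_mul]
    have e1 : ∀ x : EuclideanSpace ℝ (Fin n),
        MvPolynomial.eval (toComplex x).ofLp (MvPolynomial.pderiv i A) * (radialWeight 2 ‖x‖ : ℂ) =
        w x * MvPolynomial.eval (toComplex x).ofLp (MvPolynomial.pderiv i A) :=
      fun x => mul_comm _ _
    simp only [e1]
    rw [key, ← integral_neg]
    congr 1
    ext x
    simp only [map_mul, MvPolynomial.eval_X, f, toComplex]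
    ring
  · simp only [hw']
    have := (integrable_mul_radialWeight (n := n) (k := 1) one_ne_zero
      (f := fun x => -4 * ((x i : ℂ) * f x)) ?_)
    · refine this.congr (Filter.Eventually.of_forall fun x => ?_)
      simp only
      ring
    · have := hfd.continuous
      fun_prop
  · simp only [hf']
    refine (integrable_mul_radialWeight (n := n) (k := 2) two_ne_zero
      (continuous_eval_toComplex (MvPolynomial.pderiv i A))).congr
        (Filter.Eventually.of_forall fun x => mul_comm _ _)
  · exact (integrable_mul_radialWeight (n := n) (k := 2) two_ne_zero
      (continuous_eval_toComplex A)).congr (Filter.Eventually.of_forall fun x => mul_comm _ _)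

/-- Integrating `∂ᵢ (f ∂ᵢ g)` by parts and summing over `i` produces `∑ xᵢ ∂ᵢ g`, which is `m g` by
Euler's identity. -/
theorem weightIntegral_mul_polyLaplacian {f g : MvPolynomial (Fin n) ℂ} {m : ℕ}
    (hg : g.IsHomogeneous m) :
    weightIntegral 2 (f * polyLaplacian g) = 4 * (m * weightIntegral 1 (f * g)) -
      ∑ i, weightIntegral 2 (MvPolynomial.pderiv i f * MvPolynomial.pderiv i g) := by
  have h : ∀ i, weightIntegral 2 (f * MvPolynomial.pderiv i (MvPolynomial.pderiv i g)) =
      4 * weightIntegral 1 (f * (MvPolynomial.X i * MvPolynomial.pderiv i g)) -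
        weightIntegral 2 (MvPolynomial.pderiv i f * MvPolynomial.pderiv i g) := fun i => by
    have h1 := weightIntegral_pderiv (f * MvPolynomial.pderiv i g) i
    rw [MvPolynomial.pderiv_mul, weightIntegral_add two_ne_zero, mul_left_comm] at h1
    linear_combination h1
  rw [polyLaplacian, Finset.mul_sum, weightIntegral_sum two_ne_zero]
  simp only [h, Finset.sum_sub_distrib]
  congr 1
  rw [← Finset.mul_sum, ← weightIntegral_sum one_ne_zero, ← Finset.mul_sum, hg.sum_X_mul_pderiv,
    nsmul_eq_mul, ← map_natCast (MvPolynomial.C : ℂ →+* MvPolynomial (Fin n) ℂ) m, mul_left_comm,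
    weightIntegral_C_mul]

/-- Green's identity with a weight in place of a boundary: the gradient term is symmetric in `f` and
`g` and cancels. -/
theorem sub_mul_weightIntegral {f g : MvPolynomial (Fin n) ℂ} {d m : ℕ}
    (hf : f.IsHomogeneous d) (hg : g.IsHomogeneous m) :
    4 * (((m : ℂ) - d) * weightIntegral 1 (f * g)) =
      weightIntegral 2 (f * polyLaplacian g) - weightIntegral 2 (polyLaplacian f * g) := by
  have h1 := weightIntegral_mul_polyLaplacian (f := f) hg
  have h2 := weightIntegral_mul_polyLaplacian (f := g) hf
  simp only [mul_comm g, mul_comm (MvPolynomial.pderiv _ g)] at h2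
  rw [h1, h2]
  ring

theorem integral_eq_sphere_mul_radial [Nontrivial (EuclideanSpace ℝ (Fin n))]
    {f : EuclideanSpace ℝ (Fin n) → ℂ}
    (H : EuclideanSpace ℝ (Fin n) → ℂ) (φ : ℝ → ℂ)
    (hf : ∀ x : EuclideanSpace ℝ (Fin n), x ≠ 0 → f x = H (‖x‖⁻¹ • x) * φ ‖x‖) :
    ∫ x, f x = (∫ ω : sphere (0 : EuclideanSpace ℝ (Fin n)) 1, H ω ∂volume.toSphere) *
      ∫ r : Set.Ioi (0 : ℝ), φ r
        ∂Measure.volumeIoiPow (Module.finrank ℝ (EuclideanSpace ℝ (Fin n)) - 1) := by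
  let E := EuclideanSpace ℝ (Fin n)
  calc ∫ x, f x = ∫ x : ({(0)}ᶜ : Set E), f x ∂(volume.comap Subtype.val) := by
        rw [integral_subtype_comap (measurableSet_singleton _).compl fun x ↦ f x,
          restrict_compl_singleton]
    _ = ∫ x : ({(0)}ᶜ : Set E), (fun y : sphere (0 : E) 1 × Set.Ioi (0 : ℝ) => H y.1 * φ y.2)
          (homeomorphUnitSphereProd E x) ∂(volume.comap Subtype.val) := by
        congr 1
        ext x
        rw [hf x x.2]
        simp
    _ = ∫ y, (fun y : sphere (0 : E) 1 × Set.Ioi (0 : ℝ) => H y.1 * φ y.2) y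
          ∂(volume : Measure E).toSphere.prod (.volumeIoiPow (Module.finrank ℝ E - 1)) :=
        (volume : Measure E).measurePreserving_homeomorphUnitSphereProd.integral_comp
          (Homeomorph.measurableEmbedding _)
          (fun y : sphere (0 : E) 1 × Set.Ioi (0 : ℝ) => H y.1 * φ y.2)
    _ = _ := integral_prod_mul (fun ω : sphere (0 : E) 1 => H ω) (fun r : Set.Ioi (0 : ℝ) => φ r)

/-- The integral of a polynomial over the unit sphere. -/
noncomputable def sphereIntegral (A : MvPolynomial (Fin n) ℂ) : ℂ :=
  ∫ ω : sphere (0 : EuclideanSpace ℝ (Fin n)) 1,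
    MvPolynomial.eval (toComplex (ω : EuclideanSpace ℝ (Fin n))).ofLp A ∂volume.toSphere

theorem eval_toComplex_smul {A : MvPolynomial (Fin n) ℂ} {m : ℕ} (hA : A.IsHomogeneous m) (c : ℝ)
    (x : EuclideanSpace ℝ (Fin n)) :
    MvPolynomial.eval (toComplex (c • x)).ofLp A =
      (c : ℂ) ^ m * MvPolynomial.eval (toComplex x).ofLp A := by
  rw [toComplex_smul, WithLp.ofLp_smul, eval_smul_of_isHomogeneous hA]

theorem integral_eval_mul_radial [Nontrivial (EuclideanSpace ℝ (Fin n))]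
    {A : MvPolynomial (Fin n) ℂ} {m : ℕ} (hA : A.IsHomogeneous m) (φ : ℝ → ℂ) :
    ∫ x : EuclideanSpace ℝ (Fin n), MvPolynomial.eval (toComplex x).ofLp A * φ ‖x‖ =
      sphereIntegral A * ∫ r : Set.Ioi (0 : ℝ), (r : ℂ) ^ m * φ r
        ∂Measure.volumeIoiPow (Module.finrank ℝ (EuclideanSpace ℝ (Fin n)) - 1) := by
  refine integral_eq_sphere_mul_radial (fun x => MvPolynomial.eval (toComplex x).ofLp A)
    (fun r => (r : ℂ) ^ m * φ r) fun x hx => ?_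
  rw [eval_toComplex_smul hA, ← mul_assoc]
  congr 1
  have : (‖x‖ : ℂ) ≠ 0 := by simpa using hx
  push_cast
  rw [inv_pow]
  field_simp

theorem sphereIntegral_eq_zero [Nontrivial (EuclideanSpace ℝ (Fin n))]
    {A : MvPolynomial (Fin n) ℂ} {m : ℕ} (hA : A.IsHomogeneous m)
    (h : weightIntegral 1 A = 0) : sphereIntegral A = 0 := by
  rw [weightIntegral, integral_eval_mul_radial hA (fun t => (radialWeight 1 t : ℂ))] at h
  refine (mul_eq_zero.1 h).resolve_right fun h0 => ?_
  -- If the radial factor vanished, polar coordinates would give integral `0` to a continuous,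
  -- compactly supported, nonnegative function that is positive at `|x| = 1 / 2`.
  have h1 := integral_eq_sphere_mul_radial (n := n)
    (f := fun x => ((‖x‖ ^ m * radialWeight 1 ‖x‖ : ℝ) : ℂ)) (fun _ => 1)
    (fun r => (r : ℂ) ^ m * (radialWeight 1 r : ℂ)) fun x _ => by push_cast; ring
  rw [h0, mul_zero, integral_complex_ofReal, Complex.ofReal_eq_zero] at h1
  have hcont : Continuous fun x : EuclideanSpace ℝ (Fin n) => ‖x‖ ^ m * radialWeight 1 ‖x‖ := by
    have := continuous_radialWeight 1
    fun_prop
  obtain ⟨x, hx⟩ := exists_norm_eq (EuclideanSpace ℝ (Fin n)) (show (0 : ℝ) ≤ 1 / 2 by norm_num)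
  have hpos := hcont.integral_pos_of_hasCompactSupport_nonneg_nonzero (μ := volume)
    (HasCompactSupport.intro (isCompact_closedBall 0 1) fun x hx => by
      rw [radialWeight_eq_zero one_ne_zero, mul_zero]
      simpa using (not_le.1 (by simpa using hx)).le)
    (fun x => by simp only [radialWeight, Pi.zero_apply]; positivity) (x := x) (by
      rw [hx, radialWeight]
      norm_num)
  exact hpos.ne' h1

theorem weightIntegral_eq_zero [Nontrivial (EuclideanSpace ℝ (Fin n))]
    {A : MvPolynomial (Fin n) ℂ} {m : ℕ} (hA : A.IsHomogeneous m)
    (h : sphereIntegral A = 0) (k : ℕ) : weightIntegral k A = 0 := by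
  rw [weightIntegral, integral_eval_mul_radial hA (fun t => (radialWeight k t : ℂ)), h, zero_mul]

theorem setIntegral_ball_eq_zero [Nontrivial (EuclideanSpace ℝ (Fin n))]
    {A : MvPolynomial (Fin n) ℂ} {m : ℕ} (hA : A.IsHomogeneous m)
    (h : sphereIntegral A = 0) (r : ℝ) :
    ∫ x in ball (0 : EuclideanSpace ℝ (Fin n)) r, MvPolynomial.eval (toComplex x).ofLp A = 0 := by
  have h1 := integral_eval_mul_radial hA ((Set.Iio r).indicator fun _ => 1)
  rw [h, zero_mul] at h1
  rw [← integral_indicator measurableSet_ball, ← h1]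
  congr 1
  ext x
  by_cases hx : ‖x‖ < r <;> simp [hx]

/-- By Green's identity the claim for `f * g` follows from the claims for `f * Δg` (order lowered by
one, degree of `g` by two) and for `Δf * g` (degree of `f` lowered by two). The gap `d + 2 * p ≤ m`
survives both moves and keeps `m - d` nonzero. Spherical and weighted integrals of a homogeneous
polynomial vanish together as needed, since they differ by a radial factor. -/
theorem sphereIntegral_mul_eq_zero [Nontrivial (EuclideanSpace ℝ (Fin n))] (p : ℕ) :
    ∀ (d : ℕ) {m : ℕ} {f g : MvPolynomial (Fin n) ℂ}, f.IsHomogeneous d → g.IsHomogeneous m →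
      polyLaplacian^[p] g = 0 → d + 2 * p ≤ m → sphereIntegral (f * g) = 0 := by
  have hz : sphereIntegral (0 : MvPolynomial (Fin n) ℂ) = 0 := by simp [sphereIntegral]
  induction p with
  | zero =>
    intro d m f g _ _ hg0 _
    have : g = 0 := hg0
    rw [this, mul_zero, hz]
  | succ p ihp =>
    intro d
    induction d using Nat.strong_induction_on with
    | _ d ihd =>
      intro m f g hf hg hg0 hm
      refine sphereIntegral_eq_zero (hf.mul hg) ?_
      have h1 : weightIntegral 2 (f * polyLaplacian g) = 0 := by
        refine weightIntegral_eq_zero (hf.mul (isHomogeneous_polyLaplacian hg)) ?_ 2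
        exact ihp d hf (isHomogeneous_polyLaplacian hg) hg0 (by omega)
      have h2 : weightIntegral 2 (polyLaplacian f * g) = 0 := by
        refine weightIntegral_eq_zero ((isHomogeneous_polyLaplacian hf).mul hg) ?_ 2
        rcases lt_or_ge d 2 with hd | hd
        · rw [polyLaplacian_eq_zero_of_lt hf hd, zero_mul, hz]
        · exact ihd (d - 2) (by omega) (isHomogeneous_polyLaplacian hf) hg hg0 (by omega)
      have h3 := sub_mul_weightIntegral hf hg
      rw [h1, h2, sub_zero] at h3
      have hne : (m : ℂ) - d ≠ 0 := by
        rw [sub_ne_zero]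
        exact_mod_cast (by omega : m ≠ d)
      simpa [hne] using h3

end Orthogonality

/-! ### The homogeneous expansion at the origin -/

section HomogeneousParts

variable {n : ℕ}

/-- The homogeneous part of degree `m` of the Taylor expansion at `0`, as a polynomial. -/
noncomputable def homPart (F : EuclideanSpace ℂ (Fin n) → ℂ) (m : ℕ) : MvPolynomial (Fin n) ℂ :=
  ∑ r : Fin m → Fin n, MvPolynomial.C (taylorAt F 0 m fun k => EuclideanSpace.single (r k) 1) *
    ∏ k, MvPolynomial.X (r k)

theorem isHomogeneous_homPart (F : EuclideanSpace ℂ (Fin n) → ℂ) (m : ℕ) :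
    (homPart F m).IsHomogeneous m := by
  refine MvPolynomial.IsHomogeneous.sum _ _ _ fun r _ => ?_
  have h := MvPolynomial.IsHomogeneous.prod Finset.univ
    (fun k : Fin m => (MvPolynomial.X (r k) : MvPolynomial (Fin n) ℂ)) (fun _ => 1)
    fun k _ => MvPolynomial.isHomogeneous_X ℂ (r k)
  simp only [Finset.sum_const, Finset.card_univ, Fintype.card_fin, smul_eq_mul, mul_one] at h
  exact h.C_mul _

theorem eval_homPart (F : EuclideanSpace ℂ (Fin n) → ℂ) (m : ℕ) (z : EuclideanSpace ℂ (Fin n)) :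
    MvPolynomial.eval z.ofLp (homPart F m) = taylorAt F 0 m fun _ => z := by
  have hz : z = ∑ j, z.ofLp j • EuclideanSpace.single j (1 : ℂ) := by
    ext i
    simp [Pi.single_apply]
  conv_rhs => rw [hz]
  rw [ContinuousMultilinearMap.map_sum]
  simp only [homPart, map_sum, map_mul, MvPolynomial.eval_C, map_prod, MvPolynomial.eval_X]
  refine Finset.sum_congr rfl fun r _ => ?_
  rw [ContinuousMultilinearMap.map_smul_univ, smul_eq_mul, mul_comm]

theorem homPart_add_smul {F G : EuclideanSpace ℂ (Fin n) → ℂ} (hF : AnalyticAt ℂ F 0)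
    (hG : AnalyticAt ℂ G 0) (a : ℂ) (m : ℕ) :
    homPart (F + a • G) m = homPart F m + MvPolynomial.C a * homPart G m := by
  have hG' : ContDiffAt ℂ m (a • G) 0 := hG.contDiffAt.const_smul a
  have h : taylorAt (F + a • G) 0 m = taylorAt F 0 m + a • taylorAt G 0 m := by
    rw [taylorAt, taylorAt, taylorAt, iteratedFDeriv_add_apply hF.contDiffAt hG', iteratedFDeriv_const_smul_apply hG.contDiffAt,
      smul_add, smul_comm]
  simp only [homPart, h, Finset.mul_sum, ← Finset.sum_add_distrib, ← mul_assoc, ← add_mul,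
    ← map_mul, ← map_add]
  rfl

theorem iterate_polyLaplacian_add_C_mul (A A' : MvPolynomial (Fin n) ℂ) (a : ℂ) (p : ℕ) :
    polyLaplacian^[p] (A + MvPolynomial.C a * A') =
      polyLaplacian^[p] A + MvPolynomial.C a * polyLaplacian^[p] A' := by
  induction p with
  | zero => rfl
  | succ p ih =>
    simp only [Function.iterate_succ_apply', ih]
    simp only [polyLaplacian, map_add, MvPolynomial.pderiv_C_mul, Finset.sum_add_distrib,
      Finset.mul_sum]

theorem polyLaplacian_sum {ι : Type*} (s : Finset ι) (A : ι → MvPolynomial (Fin n) ℂ) :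
    polyLaplacian (∑ i ∈ s, A i) = ∑ i ∈ s, polyLaplacian (A i) := by
  simp only [polyLaplacian, map_sum]
  rw [Finset.sum_comm]

theorem iterate_polyLaplacian_sum {ι : Type*} (s : Finset ι) (A : ι → MvPolynomial (Fin n) ℂ)
    (p : ℕ) : polyLaplacian^[p] (∑ i ∈ s, A i) = ∑ i ∈ s, polyLaplacian^[p] (A i) := by
  induction p with
  | zero => rfl
  | succ p ih => simp only [Function.iterate_succ_apply', ih, polyLaplacian_sum]

theorem iterate_holLaplacian_eval (A : MvPolynomial (Fin n) ℂ) (p : ℕ) :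
    holLaplacian^[p] (fun z => MvPolynomial.eval z.ofLp A) =
      fun z => MvPolynomial.eval z.ofLp (polyLaplacian^[p] A) := by
  induction p with
  | zero => rfl
  | succ p ih => simp only [Function.iterate_succ_apply', ih, holLaplacian_eval]

/-- The factor `t ^ (2 * p)` avoids the exponent `m - 2 * p`; when `m < 2 * p` the iterated
Laplacian is `0` and both sides vanish. -/
theorem eval_iterate_polyLaplacian_smul {A : MvPolynomial (Fin n) ℂ} {m : ℕ}
    (hA : A.IsHomogeneous m) (p : ℕ) (t : ℂ) (z : Fin n → ℂ) :
    t ^ (2 * p) * MvPolynomial.eval (t • z) (polyLaplacian^[p] A) =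
      t ^ m * MvPolynomial.eval z (polyLaplacian^[p] A) := by
  have key : polyLaplacian^[p] A = 0 ∨
      (2 * p ≤ m ∧ (polyLaplacian^[p] A).IsHomogeneous (m - 2 * p)) := by
    induction p with
    | zero => exact Or.inr ⟨by omega, hA⟩
    | succ p ih =>
      rw [Function.iterate_succ_apply']
      rcases ih with h | ⟨hp, h⟩
      · left; rw [h, polyLaplacian_zero]
      · rcases lt_or_ge (m - 2 * p) 2 with h2 | h2
        · left; exact polyLaplacian_eq_zero_of_lt h h2
        · refine Or.inr ⟨by omega, ?_⟩
          have := isHomogeneous_polyLaplacian h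
          rwa [show m - 2 * p - 2 = m - 2 * (p + 1) by omega] at this
  rcases key with h | ⟨hp, h⟩
  · simp [h]
  · rw [eval_smul_of_isHomogeneous h, ← mul_assoc, ← pow_add, Nat.add_sub_cancel' hp]

theorem eq_zero_of_tendsto_powerSeries {c : ℕ → ℂ} {ε : ℝ} (hε : 0 < ε)
    (h : ∀ t : ℝ, t ≠ 0 → |t| < ε → Filter.Tendsto
      (fun N => ∑ k ∈ Finset.range N, c k * (t : ℂ) ^ k) Filter.atTop (nhds 0)) (k : ℕ) :
    c k = 0 := by
  -- The sum of the series is `0` away from `0` and `c 0` at `0`; continuity of a power series then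
  -- forces `c 0 = 0`, after which uniqueness applies.
  set f : ℝ → ℂ := Function.update 0 0 (c 0)
  set P : FormalMultilinearSeries ℝ ℝ ℂ := fun k => ContinuousMultilinearMap.mkPiRing ℝ (Fin k) (c k)
  have hPc : ∀ k, P.coeff k = c k := fun k => by simp [P, FormalMultilinearSeries.coeff]
  have hP : HasFPowerSeriesAt f P 0 := by
    rw [hasFPowerSeriesAt_iff]
    filter_upwards [Metric.ball_mem_nhds (0 : ℝ) hε] with t ht
    have ht' : |t| < ε := by simpa using ht
    simp only [hPc, zero_add]
    rcases eq_or_ne t 0 with h0 | h0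
    · subst h0
      have : f 0 = c 0 := by simp [f]
      rw [this]
      have h1 := hasSum_single (f := fun k => (0 : ℝ) ^ k • c k) 0 fun k hk => by simp [hk]
      simpa using h1
    · have hf : f t = 0 := by simp [f, h0]
      rw [hf]
      obtain ⟨s, hts, hs⟩ := exists_between ht'
      have hs0 : 0 < s := (abs_nonneg t).trans_lt hts
      have hsum := summable_powerSeries_of_norm_lt (f := c) (w := (s : ℂ)) (z := (t : ℂ))
        (h s hs0.ne' (by rwa [abs_of_pos hs0])).cauchySeq (by simpa [abs_of_pos hs0] using hts)
      have h2 := tendsto_nhds_unique hsum.hasSum.tendsto_sum_nat (h t h0 ht')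
      have h3 := hsum.hasSum
      rw [h2] at h3
      have he : (fun k => t ^ k • c k) = fun k => c k * (t : ℂ) ^ k := by
        ext k
        rw [Complex.real_smul, mul_comm, Complex.ofReal_pow]
      rw [he]
      exact h3
  have hc0 : c 0 = 0 := by
    have hcont := hP.continuousAt
    have h1 : Filter.Tendsto f (nhdsWithin 0 {0}ᶜ) (nhds (f 0)) :=
      hcont.tendsto.mono_left nhdsWithin_le_nhds
    have h2 : Filter.Tendsto f (nhdsWithin 0 {0}ᶜ) (nhds 0) := by
      refine tendsto_const_nhds.congr' ?_
      filter_upwards [self_mem_nhdsWithin] with t ht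
      have : t ≠ 0 := ht
      simp [f, this]
    have := tendsto_nhds_unique h1 h2
    simpa [f] using this
  have hf0 : f = 0 := by simp [f, hc0]
  rw [hf0] at hP
  rw [← hPc, hP.eq_zero]
  simp [FormalMultilinearSeries.coeff]

theorem _root_.HasFPowerSeriesOnBall.apply_eq_taylorAt {F : EuclideanSpace ℂ (Fin n) → ℂ}
    {q : FormalMultilinearSeries ℂ (EuclideanSpace ℂ (Fin n)) ℂ} {r : ℝ≥0∞}
    (hq : HasFPowerSeriesOnBall F q 0 r) (k : ℕ) (z : EuclideanSpace ℂ (Fin n)) :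
    (q k fun _ => z) = taylorAt F 0 k fun _ => z := by
  have h := hq.factorial_smul z k
  have hk : (k.factorial : ℂ) ≠ 0 := by exact_mod_cast k.factorial_ne_zero
  rw [taylorAt, smul_apply, ← h, nsmul_eq_mul, smul_eq_mul,
    inv_mul_cancel_left₀ hk]

/-- The homogeneous parts of a polyharmonic function are polyharmonic. -/
theorem iterate_polyLaplacian_homPart {F : EuclideanSpace ℂ (Fin n) → ℂ} {p : ℕ}
    (hF : AnalyticAt ℂ F 0)
    (hp : ∀ᶠ x in nhds (0 : EuclideanSpace ℝ (Fin n)), holLaplacian^[p] F (toComplex x) = 0)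
    (m : ℕ) : polyLaplacian^[p] (homPart F m) = 0 := by
  obtain ⟨q, r, hq⟩ := hF
  have hlim := hq.tendstoLocallyUniformlyOn
  have hps : ∀ N z, q.partialSum N z =
      MvPolynomial.eval z.ofLp (∑ k ∈ Finset.range N, homPart F k) := fun N z => by
    simp only [FormalMultilinearSeries.partialSum, hq.apply_eq_taylorAt, map_sum, eval_homPart]
  simp only [hps, zero_add] at hlim
  have hlap := TendstoLocallyUniformlyOn.iterate_holLaplacian isOpen_eball
    (fun j z _ => analyticAt_eval_ofLp _ z) hlim p
  simp only [iterate_holLaplacian_eval, iterate_polyLaplacian_sum] at hlap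
  -- A polynomial that vanishes at all real points is zero.
  refine MvPolynomial.funext_set (fun _ => Set.range Complex.ofReal)
    (fun _ => Set.infinite_range_of_injective Complex.ofReal_injective) fun y hy => ?_
  choose x hx using fun i => hy i trivial
  have hxy : (toComplex (WithLp.toLp 2 x)).ofLp = y := by
    ext i; simp [toComplex, hx]
  set X : EuclideanSpace ℝ (Fin n) := WithLp.toLp 2 x
  have hcont : Filter.Tendsto (fun t : ℝ => t • X) (nhds 0) (nhds 0) := by
    have : Continuous fun t : ℝ => t • X := by fun_prop
    simpa using this.tendsto 0
  have hcont2 : Filter.Tendsto (fun t : ℝ => toComplex (t • X)) (nhds 0) (nhds 0) := by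
    have : toComplex (0 : EuclideanSpace ℝ (Fin n)) = 0 := (toComplexL n).map_zero
    rw [← this]
    exact (continuous_toComplex.tendsto 0).comp hcont
  obtain ⟨ε, hε, hball⟩ := Metric.eventually_nhds_iff_ball.1
    ((hcont.eventually hp).and (hcont2.eventually (eball_mem_nhds _ hq.r_pos)))
  -- Along the real ray `t X`, the Laplacians of the partial sums become, after multiplication by `t
  -- ^ (2 * p)`, a power series in `t` that converges to `0`.
  have hzero := eq_zero_of_tendsto_powerSeries
    (c := fun k => MvPolynomial.eval y (polyLaplacian^[p] (homPart F k))) hε fun t ht0 ht => by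
      obtain ⟨h1, h2⟩ := hball t (by simpa using ht)
      have h3 := hlap.tendsto_at h2
      rw [h1] at h3
      have h4 := h3.const_mul ((t : ℂ) ^ (2 * p))
      rw [mul_zero] at h4
      refine h4.congr fun N => ?_
      rw [map_sum, Finset.mul_sum]
      refine Finset.sum_congr rfl fun k _ => ?_
      rw [toComplex_smul, WithLp.ofLp_smul, hxy,
        eval_iterate_polyLaplacian_smul (isHomogeneous_homPart F k), mul_comm]
  rw [hzero m, map_zero]

theorem smul_mem_allRotations {z : EuclideanSpace ℂ (Fin n)} {x : EuclideanSpace ℝ (Fin n)} {ψ : ℝ}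
    (hz : z = rotate ψ x) {l : ℂ} (hl : ‖l‖ * ‖x‖ < 1) : l • z ∈ allRotations n := by
  refine ⟨l.arg + ψ, ‖l‖ • x, by simpa [norm_smul] using hl, ?_⟩
  rw [hz, rotate, rotate, toComplex_smul, smul_smul, smul_smul]
  congr 1
  conv_lhs => rw [← Complex.norm_mul_exp_arg_mul_I l]
  push_cast
  rw [add_mul, Complex.exp_add]
  ring

theorem zero_mem_allRotations : (0 : EuclideanSpace ℂ (Fin n)) ∈ allRotations n := by
  have h := smul_mem_allRotations (n := n) (z := rotate 0 0) (x := 0) (ψ := 0) rfl (l := 0) (by simp)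
  rwa [zero_smul] at h

theorem differentiableOn_slice_of_allRotations {F : EuclideanSpace ℂ (Fin n) → ℂ}
    (hF : AnalyticOnNhd ℂ F (allRotations n)) {z : EuclideanSpace ℂ (Fin n)}
    {x : EuclideanSpace ℝ (Fin n)} {ψ : ℝ} (hz : z = rotate ψ x) {R : ℝ} (hR : R * ‖x‖ < 1) :
    DifferentiableOn ℂ (fun l : ℂ => F (0 + l • z)) (closedBall 0 R) := by
  intro l hl
  have hl' : ‖l‖ ≤ R := by simpa using hl
  have hmem : (0 : EuclideanSpace ℂ (Fin n)) + l • z ∈ allRotations n := by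
    rw [zero_add]
    exact smul_mem_allRotations hz
      ((mul_le_mul_of_nonneg_right hl' (norm_nonneg x)).trans_lt hR)
  have h1 : DifferentiableAt ℂ (fun l : ℂ => (0 : EuclideanSpace ℂ (Fin n)) + l • z) l := by fun_prop
  exact ((hF _ hmem).differentiableAt.comp l h1).differentiableWithinAt

/-- A point `e^{iψ} x` with `|x| < 1` lies inside a disc of radius larger than `1`, in its own
scale, on the complex line through `0`; there the one-variable expansion converges. -/
theorem hasSum_homPart {F : EuclideanSpace ℂ (Fin n) → ℂ}
    (hF : AnalyticOnNhd ℂ F (allRotations n)) {z : EuclideanSpace ℂ (Fin n)}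
    (hz : z ∈ allRotations n) :
    HasSum (fun m => MvPolynomial.eval z.ofLp (homPart F m)) (F z) := by
  obtain ⟨ψ, x, hx, hzx⟩ := hz
  have hx1 : ‖x‖ < 1 := by simpa using hx
  obtain ⟨R, hR, hR1⟩ : ∃ R : ℝ, 1 < R ∧ R * ‖x‖ < 1 := by
    have : ContinuousAt (fun R : ℝ => R * ‖x‖) 1 := by fun_prop
    have h1 : ∀ᶠ R in nhdsWithin (1 : ℝ) (Set.Ioi 1), R * ‖x‖ < 1 :=
      (this.tendsto.eventually (gt_mem_nhds (by simpa using hx1))).filter_mono nhdsWithin_le_nhds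
    obtain ⟨R, h2, h3⟩ := (h1.and self_mem_nhdsWithin).exists
    exact ⟨R, h3, h2⟩
  have h := hasSum_taylorAt_of_slice (hF 0 zero_mem_allRotations) hR
    (differentiableOn_slice_of_allRotations hF hzx hR1)
  simpa only [eval_homPart, zero_add] using h

/-- Cauchy's estimate on slices through a compact set of radius `s` with `r < s < 1` bounds every
part at radius `s`; homogeneity then gives the ratio `r / s` at radius `r`. -/
theorem exists_norm_homPart_le {F : EuclideanSpace ℂ (Fin n) → ℂ}
    (hF : AnalyticOnNhd ℂ F (allRotations n)) {r : ℝ} (hr0 : 0 < r) (hr : r < 1) :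
    ∃ M ρ : ℝ, 0 ≤ M ∧ 0 ≤ ρ ∧ ρ < 1 ∧ ∀ x ∈ closedBall (0 : EuclideanSpace ℝ (Fin n)) r, ∀ m,
      ‖MvPolynomial.eval (toComplex x).ofLp (homPart F m)‖ ≤ M * ρ ^ m := by
  obtain ⟨s, hrs, hs⟩ := exists_between hr
  have hs0 : 0 < s := hr0.trans hrs
  have hrot : ∀ y : EuclideanSpace ℝ (Fin n), toComplex y = rotate 0 y := fun y => by
    simp [rotate]
  set K : Set (EuclideanSpace ℂ (Fin n)) :=
    (fun q : ℂ × EuclideanSpace ℝ (Fin n) => q.1 • toComplex q.2) ''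
      (closedBall 0 1 ×ˢ closedBall 0 s)
  have hK : IsCompact K := by
    refine ((isCompact_closedBall _ _).prod (isCompact_closedBall _ _)).image ?_
    have := continuous_toComplex (n := n)
    fun_prop
  have hKsub : K ⊆ allRotations n := by
    rintro _ ⟨⟨l, y⟩, ⟨hl, hy⟩, rfl⟩
    refine smul_mem_allRotations (hrot y) ?_
    have h1 : ‖l‖ ≤ 1 := by simpa using hl
    have h2 : ‖y‖ ≤ s := by simpa using hy
    calc ‖l‖ * ‖y‖ ≤ 1 * s := by gcongr
      _ < 1 := by linarith
  obtain ⟨M, hM⟩ := hK.exists_bound_of_continuousOn (hF.continuousOn.mono hKsub)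
  have hM0 : 0 ≤ M := (norm_nonneg _).trans (hM 0 ⟨(0, 0), by simp [hs0.le], by simp⟩)
  refine ⟨M, r / s, hM0, by positivity, (div_lt_one hs0).2 hrs, fun x hx m => ?_⟩
  have hx' : ‖x‖ ≤ r := by simpa using hx
  set y := (s / r) • x
  have hy : ‖y‖ ≤ s := by
    simp only [y, norm_smul, norm_div, Real.norm_of_nonneg hs0.le, Real.norm_of_nonneg hr0.le]
    rw [div_mul_eq_mul_div, div_le_iff₀ hr0]
    gcongr
  have hxy : x = (r / s) • y := by
    simp only [y, smul_smul]
    rw [div_mul_div_cancel₀ hs0.ne', div_self hr0.ne', one_smul]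
  have hb := norm_taylorAt_le_of_slice (hF 0 zero_mem_allRotations) (h := toComplex y)
    (differentiableOn_slice_of_allRotations hF (hrot y) (by linarith)) (M := M) (fun l hl => by
      rw [zero_add]
      exact hM _ ⟨(l, y), by simpa [hl] using hy, rfl⟩) m
  rw [← eval_homPart] at hb
  rw [hxy, eval_toComplex_smul (isHomogeneous_homPart F m), norm_mul, norm_pow, Complex.norm_real,
    Real.norm_of_nonneg (by positivity), mul_comm]
  gcongr

end HomogeneousParts

/-! ### Vanishing of the cross terms -/

section Conjugate

variable {n : ℕ}

/-- The polynomial with conjugate coefficients. -/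
noncomputable def conjPoly (A : MvPolynomial (Fin n) ℂ) : MvPolynomial (Fin n) ℂ :=
  MvPolynomial.map (starRingEnd ℂ) A

theorem eval_conjPoly (A : MvPolynomial (Fin n) ℂ) (x : EuclideanSpace ℝ (Fin n)) :
    MvPolynomial.eval (toComplex x).ofLp (conjPoly A) =
      (starRingEnd ℂ) (MvPolynomial.eval (toComplex x).ofLp A) := by
  rw [conjPoly, MvPolynomial.eval_map, ← MvPolynomial.eval₂_id, MvPolynomial.eval₂_comp_right,
    MvPolynomial.map_id]
  congr 1
  ext i
  simp [toComplex]

theorem iterate_polyLaplacian_conjPoly (A : MvPolynomial (Fin n) ℂ) (p : ℕ) :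
    polyLaplacian^[p] (conjPoly A) = conjPoly (polyLaplacian^[p] A) := by
  induction p with
  | zero => rfl
  | succ p ih =>
    simp only [Function.iterate_succ_apply', ih]
    simp only [polyLaplacian, conjPoly, map_sum, MvPolynomial.pderiv_map]

theorem setIntegral_ball_eq_zero_of_odd {A : MvPolynomial (Fin n) ℂ} {m : ℕ}
    (hA : A.IsHomogeneous m) (hm : Odd m) (r : ℝ) :
    ∫ x in ball (0 : EuclideanSpace ℝ (Fin n)) r, MvPolynomial.eval (toComplex x).ofLp A = 0 := by
  rw [← integral_indicator measurableSet_ball]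
  set f := (ball (0 : EuclideanSpace ℝ (Fin n)) r).indicator fun x =>
    MvPolynomial.eval (toComplex x).ofLp A
  have h1 := integral_neg_eq_self f volume
  have h2 : ∀ x, f (-x) = - f x := fun x => by
    have h3 := eval_toComplex_smul hA (-1) x
    push_cast at h3
    rw [neg_one_smul, hm.neg_one_pow, neg_one_mul] at h3
    by_cases hx : ‖x‖ < r <;> simp [f, hx, h3]
  simp only [h2, integral_neg] at h1
  linear_combination (-1 / 2 : ℂ) * h1

/-- The terms are the powers of `exp (2πis/p)`, a `p`-th root of unity different from `1` because
`p` does not divide `s`. -/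
theorem sum_exp_angle_eq_zero {p : ℕ} (hp : 1 ≤ p) {s : ℤ} (hs0 : s ≠ 0) (hs : |s| < p) :
    ∑ k : Fin p, Complex.exp (2 * s * (angle p k : ℂ) * Complex.I) = 0 := by
  have hp0 : (p : ℂ) ≠ 0 := by exact_mod_cast (by omega : p ≠ 0)
  set ζ := Complex.exp (2 * s * Real.pi / p * Complex.I) with hζ
  have h1 : ∀ k : Fin p, Complex.exp (2 * s * (angle p k : ℂ) * Complex.I) = ζ ^ (k : ℕ) := by
    intro k
    rw [hζ, ← Complex.exp_nat_mul]
    congr 1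
    simp only [angle]
    push_cast
    ring
  simp only [h1]
  rw [Fin.sum_univ_eq_sum_range (fun k => ζ ^ k)]
  have h2 : ζ ^ p = 1 := by
    rw [hζ, ← Complex.exp_nat_mul, Complex.exp_eq_one_iff]
    refine ⟨s, ?_⟩
    field_simp
  have h3 : ζ - 1 ≠ 0 := by
    rw [sub_ne_zero]
    intro h
    rw [hζ, Complex.exp_eq_one_iff] at h
    obtain ⟨N, hN⟩ := h
    have hpi : (Real.pi : ℂ) ≠ 0 := by exact_mod_cast Real.pi_ne_zero
    have h4 : (s : ℂ) = N * p := by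
      field_simp at hN
      have := mul_left_cancel₀ (mul_ne_zero (mul_ne_zero two_ne_zero hpi) Complex.I_ne_zero)
        (show 2 * (Real.pi : ℂ) * Complex.I * s = 2 * Real.pi * Complex.I * (N * p) by
          linear_combination 2 * Real.pi * Complex.I * hN)
      exact this
    have h5 : s = N * p := by exact_mod_cast h4
    have hN0 : N ≠ 0 := fun h => hs0 (by rw [h5, h, zero_mul])
    have : (1 : ℤ) ≤ |N| := Int.one_le_abs hN0
    rw [h5, abs_mul, Nat.abs_cast] at hs
    nlinarith
  have h4 := mul_geom_sum ζ p
  rw [h2, sub_self] at h4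
  exact (mul_eq_zero.1 h4).resolve_left h3

/-- Averaging over the rotations kills the cross terms of homogeneous polyharmonic polynomials. -/
theorem sum_exp_mul_setIntegral_eq_zero [Nontrivial (EuclideanSpace ℝ (Fin n))] {p : ℕ}
    (hp : 1 ≤ p) {A A' : MvPolynomial (Fin n) ℂ} {m m' : ℕ} (hA : A.IsHomogeneous m)
    (hA' : A'.IsHomogeneous m') (h0 : polyLaplacian^[p] A = 0) (h0' : polyLaplacian^[p] A' = 0)
    (hne : m ≠ m') (r : ℝ) :
    (∑ k : Fin p, Complex.exp (((m : ℂ) - m') * (angle p k : ℂ) * Complex.I)) *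
      ∫ x in ball (0 : EuclideanSpace ℝ (Fin n)) r,
        MvPolynomial.eval (toComplex x).ofLp (A * A') = 0 := by
  -- For an odd total degree the integral vanishes by parity. For an even one it vanishes when the
  -- degrees differ by at least `2 * p`, and in the remaining range the exponential sum does.
  rcases Nat.even_or_odd (m + m') with he | ho
  · rcases le_or_gt (m + 2 * p) m' with h | h
    · rw [setIntegral_ball_eq_zero (hA.mul hA') (sphereIntegral_mul_eq_zero p m hA hA' h0' h) r,
        mul_zero]
    rcases le_or_gt (m' + 2 * p) m with h' | h'
    · rw [mul_comm A A', setIntegral_ball_eq_zero (hA'.mul hA)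
        (sphereIntegral_mul_eq_zero p m' hA' hA h0 h') r, mul_zero]
    obtain ⟨s, hs⟩ : ∃ s : ℤ, (m : ℤ) - m' = 2 * s := by
      obtain ⟨a, ha⟩ := he
      exact ⟨a - m', by omega⟩
    have hsc : (m : ℂ) - m' = 2 * s := by exact_mod_cast hs
    rw [hsc, sum_exp_angle_eq_zero hp (by omega) (abs_lt.2 ⟨by omega, by omega⟩), zero_mul]
  · rw [setIntegral_ball_eq_zero_of_odd (hA.mul hA') ho, mul_zero]

end Conjugate

/-! ### The Bessel inequality for homogeneous parts -/

section Bessel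

variable {n p : ℕ}

theorem rotate_mem_allRotations {x : EuclideanSpace ℝ (Fin n)} (hx : x ∈ B n) (φ : ℝ) :
    rotate φ x ∈ allRotations n := ⟨φ, x, hx, rfl⟩

theorem hatB_subset_allRotations : hatB n p ⊆ allRotations n := by
  intro z hz
  obtain ⟨k, x, hx, rfl⟩ := Set.mem_iUnion.1 hz
  exact rotate_mem_allRotations hx _

theorem continuous_rotate (φ : ℝ) : Continuous (rotate (n := n) φ) := by
  have := continuous_toComplex (n := n)
  unfold rotate
  fun_prop

theorem continuous_rot (k : Fin p) : Continuous (rot (n := n) k) :=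
  ((continuous_rotate _).comp continuous_subtype_val).subtype_mk _

theorem eval_rotate {A : MvPolynomial (Fin n) ℂ} {m : ℕ} (hA : A.IsHomogeneous m) (φ : ℝ)
    (x : EuclideanSpace ℝ (Fin n)) :
    MvPolynomial.eval (rotate φ x).ofLp A =
      Complex.exp (m * (φ : ℂ) * Complex.I) * MvPolynomial.eval (toComplex x).ofLp A := by
  rw [rotate, WithLp.ofLp_smul, eval_smul_of_isHomogeneous hA, ← Complex.exp_nat_mul, mul_assoc]

/-- Termwise integration is justified by the uniform geometric bound on a ball of radius `r < 1`;
nothing is assumed up to the boundary. -/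
theorem hasSum_setIntegral_rotate {F : EuclideanSpace ℂ (Fin n) → ℂ}
    (hF : AnalyticOnNhd ℂ F (allRotations n)) {r : ℝ} (hr0 : 0 < r) (hr : r < 1)
    (A : MvPolynomial (Fin n) ℂ) (φ : ℝ) :
    HasSum (fun m : ℕ => Complex.exp (m * (φ : ℂ) * Complex.I) *
        ∫ x in ball (0 : EuclideanSpace ℝ (Fin n)) r,
          MvPolynomial.eval (toComplex x).ofLp (homPart F m * A))
      (∫ x in ball (0 : EuclideanSpace ℝ (Fin n)) r,
        F (rotate φ x) * MvPolynomial.eval (toComplex x).ofLp A) := by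
  obtain ⟨M, ρ, hM, hρ0, hρ1, hb⟩ := exists_norm_homPart_le hF hr0 hr
  obtain ⟨N, hN⟩ := (isCompact_closedBall (0 : EuclideanSpace ℝ (Fin n)) r).exists_bound_of_continuousOn
    (continuous_eval_toComplex A).continuousOn
  simp only [← integral_const_mul]
  have hgeo : Summable fun m : ℕ => M * ρ ^ m * N :=
    ((summable_geometric_of_lt_one hρ0 hρ1).mul_left M).mul_right N
  refine hasSum_integral_of_dominated_convergence (fun m _ => M * ρ ^ m * N) (fun m => ?_)
    (fun m => ?_) (Filter.Eventually.of_forall fun _ => hgeo) ?_ ?_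
  · exact (continuous_const.mul (continuous_eval_toComplex _)).aestronglyMeasurable
  · refine (ae_restrict_iff' measurableSet_ball).2 (Filter.Eventually.of_forall fun x hx => ?_)
    have hx' := ball_subset_closedBall hx
    have he : ‖Complex.exp (m * (φ : ℂ) * Complex.I)‖ = 1 := by
      have := Complex.norm_exp_ofReal_mul_I (m * φ)
      push_cast at this
      exact this
    rw [norm_mul, he, one_mul, map_mul, norm_mul]
    exact mul_le_mul (hb x hx' m) (hN x hx') (norm_nonneg _) (by positivity)
  · exact integrableOn_const (by finiteness)
  · refine (ae_restrict_iff' measurableSet_ball).2 (Filter.Eventually.of_forall fun x hx => ?_)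
    have hxB : x ∈ B n := ball_subset_ball hr.le hx
    have h := (hasSum_homPart hF (rotate_mem_allRotations hxB φ)).mul_right
      (MvPolynomial.eval (toComplex x).ofLp A)
    simp only [eval_rotate (isHomogeneous_homPart F _)] at h
    simpa only [map_mul, mul_assoc] using h

/-- The projection of the rotated values of a polyharmonic function on a homogeneous part. -/
theorem average_setIntegral_rotate [Nontrivial (EuclideanSpace ℝ (Fin n))] (hp : 1 ≤ p)
    {F : EuclideanSpace ℂ (Fin n) → ℂ} (hF : AnalyticOnNhd ℂ F (allRotations n))
    (hpoly : ∀ m, polyLaplacian^[p] (homPart F m) = 0) {r : ℝ} (hr0 : 0 < r) (hr : r < 1) (m : ℕ) :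
    ∑ k : Fin p, Complex.exp (-(m * (angle p k : ℂ) * Complex.I)) *
      ∫ x in ball (0 : EuclideanSpace ℝ (Fin n)) r,
        F (rotate (angle p k) x) * (starRingEnd ℂ) (MvPolynomial.eval (toComplex x).ofLp (homPart F m)) =
      p * ((∫ x in ball (0 : EuclideanSpace ℝ (Fin n)) r,
        ‖MvPolynomial.eval (toComplex x).ofLp (homPart F m)‖ ^ 2 : ℝ) : ℂ) := by
  have h1 : HasSum (fun j : ℕ => ∑ k : Fin p, Complex.exp (-(m * (angle p k : ℂ) * Complex.I)) *
      (Complex.exp (j * (angle p k : ℂ) * Complex.I) *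
        ∫ x in ball (0 : EuclideanSpace ℝ (Fin n)) r,
          MvPolynomial.eval (toComplex x).ofLp (homPart F j * conjPoly (homPart F m)))) _ :=
    hasSum_sum fun k _ =>
      (hasSum_setIntegral_rotate hF hr0 hr (conjPoly (homPart F m)) (angle p k)).mul_left
        (Complex.exp (-(m * (angle p k : ℂ) * Complex.I)))
  simp only [eval_conjPoly] at h1
  have hconj : (conjPoly (homPart F m)).IsHomogeneous m := (isHomogeneous_homPart F m).map _
  have hcp : polyLaplacian^[p] (conjPoly (homPart F m)) = 0 := by
    rw [iterate_polyLaplacian_conjPoly, hpoly, conjPoly, map_zero]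
  have hterm : ∀ j : ℕ, ∑ k : Fin p, Complex.exp (-(m * (angle p k : ℂ) * Complex.I)) *
      (Complex.exp (j * (angle p k : ℂ) * Complex.I) *
        ∫ x in ball (0 : EuclideanSpace ℝ (Fin n)) r,
          MvPolynomial.eval (toComplex x).ofLp (homPart F j * conjPoly (homPart F m))) =
      (∑ k : Fin p, Complex.exp (((j : ℂ) - m) * (angle p k : ℂ) * Complex.I)) *
        ∫ x in ball (0 : EuclideanSpace ℝ (Fin n)) r,
          MvPolynomial.eval (toComplex x).ofLp (homPart F j * conjPoly (homPart F m)) := by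
    intro j
    rw [Finset.sum_mul]
    refine Finset.sum_congr rfl fun k _ => ?_
    rw [← mul_assoc, ← Complex.exp_add]
    congr 2
    ring
  -- All terms with `j ≠ m` vanish after averaging over the rotations.
  have h2 := hasSum_single m fun j hj => (hterm j).trans
    (sum_exp_mul_setIntegral_eq_zero hp (isHomogeneous_homPart F j) hconj (hpoly j) hcp hj r)
  rw [h1.unique h2, hterm m]
  have h3 : (fun x : EuclideanSpace ℝ (Fin n) =>
      MvPolynomial.eval (toComplex x).ofLp (homPart F m * conjPoly (homPart F m))) =
      fun x => ((‖MvPolynomial.eval (toComplex x).ofLp (homPart F m)‖ ^ 2 : ℝ) : ℂ) := by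
    ext x
    rw [map_mul, eval_conjPoly, Complex.mul_conj']
    push_cast
    rfl
  rw [h3, integral_complex_ofReal]
  simp

theorem map_rot_le (hp : 1 ≤ p) (k : Fin p) :
    Measure.map (rot k) (volB n) ≤ (p : ℝ≥0∞) • hatMeasure n p := by
  have hp0 : (p : ℝ≥0∞) ≠ 0 := by exact_mod_cast (by omega : p ≠ 0)
  rw [hatMeasure, smul_smul, ENNReal.mul_inv_cancel hp0 (by finiteness), one_smul]
  intro s
  rw [Measure.finsetSum_apply]
  exact Finset.single_le_sum (f := fun k => Measure.map (rot k) (volB n) s)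
    (fun _ _ => by simp) (Finset.mem_univ k)

theorem _root_.MeasureTheory.MemLp.comp_rot (hp : 1 ≤ p) {u : hatB n p → ℂ}
    (hu : MemLp u 2 (hatMeasure n p)) (k : Fin p) : MemLp (fun y => u (rot k y)) 2 (volB n) := by
  have h := hu.of_measure_le_smul (c := (p : ℝ≥0∞)) (by finiteness) (map_rot_le hp k)
  exact (memLp_map_measure_iff h.1 (continuous_rot k).measurable.aemeasurable).1 h

theorem bergmanNorm_sq (u : hatB n p → ℂ) : bergmanNorm u ^ 2 =
    (1 / (p : ℝ)) * ∑ k : Fin p, ∫ y : B n, ‖u (rot k y)‖ ^ 2 ∂(volB n) := by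
  refine Real.sq_sqrt (mul_nonneg (by positivity) (Finset.sum_nonneg fun k _ =>
    integral_nonneg fun y => by positivity))

/-- The averaged identity expresses `p * I` as a sum of `p` pairings. The inequality `ab ≤ a²/2 +
b²/2` bounds that sum by `p ‖u‖² / 2 + p I / 2`, and the finite term with `I` is absorbed on the
left. -/
theorem setIntegral_sq_homPart_le [Nontrivial (EuclideanSpace ℝ (Fin n))] (hp : 1 ≤ p)
    {F : EuclideanSpace ℂ (Fin n) → ℂ} (hF : AnalyticOnNhd ℂ F (allRotations n))
    (hpoly : ∀ m, polyLaplacian^[p] (homPart F m) = 0)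
    (hL : MemLp (fun z : hatB n p => F z) 2 (hatMeasure n p))
    {r : ℝ} (hr0 : 0 < r) (hr : r < 1) (m : ℕ) :
    ∫ x in ball (0 : EuclideanSpace ℝ (Fin n)) r,
      ‖MvPolynomial.eval (toComplex x).ofLp (homPart F m)‖ ^ 2 ≤
      bergmanNorm (fun z : hatB n p => F z) ^ 2 := by
  have hp0 : (0 : ℝ) < p := by exact_mod_cast hp
  set I := ∫ x in ball (0 : EuclideanSpace ℝ (Fin n)) r,
      ‖MvPolynomial.eval (toComplex x).ofLp (homPart F m)‖ ^ 2
  have hI : 0 ≤ I := integral_nonneg fun x => by positivity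
  have hav := average_setIntegral_rotate hp hF hpoly hr0 hr m
  have hk : ∀ k : Fin p, ‖Complex.exp (-(m * (angle p k : ℂ) * Complex.I)) *
      ∫ x in ball (0 : EuclideanSpace ℝ (Fin n)) r, F (rotate (angle p k) x) *
        (starRingEnd ℂ) (MvPolynomial.eval (toComplex x).ofLp (homPart F m))‖ ≤
      (∫ y : B n, ‖F (rot k y)‖ ^ 2 ∂(volB n)) / 2 + I / 2 := by
    intro k
    have he : ‖Complex.exp (-(m * (angle p k : ℂ) * Complex.I))‖ = 1 := by
      have := Complex.norm_exp_ofReal_mul_I (-(m * angle p k))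
      push_cast at this
      rwa [neg_mul] at this
    rw [norm_mul, he, one_mul]
    have hsub : closedBall (0 : EuclideanSpace ℝ (Fin n)) r ⊆ B n := closedBall_subset_ball hr
    have hc1 : ContinuousOn (fun x => F (rotate (angle p k) x))
        (closedBall (0 : EuclideanSpace ℝ (Fin n)) r) :=
      hF.continuousOn.comp (continuous_rotate _).continuousOn
        fun x hx => rotate_mem_allRotations (hsub hx) _
    have hc2 := (continuous_eval_toComplex (homPart F m))
    have hint1 : IntegrableOn (fun x => ‖F (rotate (angle p k) x)‖ ^ 2)
        (ball (0 : EuclideanSpace ℝ (Fin n)) r) :=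
      ((hc1.norm.pow 2).integrableOn_compact (isCompact_closedBall 0 r)).mono_set
        ball_subset_closedBall
    have hint2 : IntegrableOn (fun x => ‖MvPolynomial.eval (toComplex x).ofLp (homPart F m)‖ ^ 2)
        (ball (0 : EuclideanSpace ℝ (Fin n)) r) :=
      ((hc2.norm.pow 2).continuousOn.integrableOn_compact (isCompact_closedBall 0 r)).mono_set
        ball_subset_closedBall
    have hbig : ∫ x in ball (0 : EuclideanSpace ℝ (Fin n)) r, ‖F (rotate (angle p k) x)‖ ^ 2 ≤
        ∫ y : B n, ‖F (rot k y)‖ ^ 2 ∂(volB n) := by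
      have hLk := (hL.comp_rot hp k).integrable_norm_pow (by norm_num)
      have hLk' : IntegrableOn (fun x => ‖F (rotate (angle p k) x)‖ ^ 2) (B n) := by
        rw [integrableOn_iff_comap_subtypeVal measurableSet_ball]
        exact hLk
      rw [volB]
      have h3 := integral_subtype_comap (μ := volume) (measurableSet_ball (x := (0 :
        EuclideanSpace ℝ (Fin n))) (ε := 1)) fun x => ‖F (rotate (angle p k) x)‖ ^ 2
      refine le_trans ?_ h3.symm.le
      exact setIntegral_mono_set hLk' (Filter.Eventually.of_forall fun x => by positivity)
        (ball_subset_ball hr.le).eventuallyLE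
    calc _ ≤ ∫ x in ball (0 : EuclideanSpace ℝ (Fin n)) r, (‖F (rotate (angle p k) x)‖ ^ 2 / 2 +
          ‖MvPolynomial.eval (toComplex x).ofLp (homPart F m)‖ ^ 2 / 2) := by
          refine norm_integral_le_of_norm_le ((hint1.div_const 2).add (hint2.div_const 2))
            (Filter.Eventually.of_forall fun x => ?_)
          rw [norm_mul, RCLike.norm_conj]
          nlinarith [sq_nonneg (‖F (rotate (angle p k) x)‖ -
            ‖MvPolynomial.eval (toComplex x).ofLp (homPart F m)‖)]
      _ = (∫ x in ball (0 : EuclideanSpace ℝ (Fin n)) r, ‖F (rotate (angle p k) x)‖ ^ 2) / 2 +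
          I / 2 := by
          rw [integral_add (hint1.div_const 2) (hint2.div_const 2), integral_div, integral_div]
      _ ≤ _ := by gcongr
  have hnorm := congrArg norm hav
  rw [norm_mul, Complex.norm_natCast, Complex.norm_real, Real.norm_of_nonneg hI] at hnorm
  have hle := (hnorm.symm.le).trans ((norm_sum_le _ _).trans (Finset.sum_le_sum fun k _ => hk k))
  rw [Finset.sum_add_distrib, Finset.sum_const, Finset.card_univ, Fintype.card_fin, nsmul_eq_mul,
    ← Finset.sum_div] at hle
  rw [bergmanNorm_sq, one_div, ← div_eq_inv_mul, le_div_iff₀ hp0]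
  linarith

/-- A Bessel inequality for the homogeneous parts. -/
theorem ballNorm_homPart_le [Nontrivial (EuclideanSpace ℝ (Fin n))] (hp : 1 ≤ p)
    {F : EuclideanSpace ℂ (Fin n) → ℂ} (hF : AnalyticOnNhd ℂ F (allRotations n))
    (hpoly : ∀ m, polyLaplacian^[p] (homPart F m) = 0)
    (hL : MemLp (fun z : hatB n p => F z) 2 (hatMeasure n p)) (m : ℕ) :
    ballNorm (homPart F m) ≤ bergmanNorm (fun z : hatB n p => F z) := by
  refine (Real.sqrt_le_left (Real.sqrt_nonneg _)).2 ?_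
  -- Radii increasing to `1`; the shift by `2` keeps the radius positive at `j = 0`.
  set s : ℕ → ℝ := fun j => 1 - 1 / ((j : ℝ) + 2)
  have hs0 : ∀ j, 0 < s j := fun j => by
    have : (1 : ℝ) / (j + 2) < 1 := (div_lt_one (by positivity)).2 (by linarith [j.cast_nonneg (α := ℝ)])
    simp only [s]; linarith
  have hs1 : ∀ j, s j < 1 := fun j => by
    have : (0 : ℝ) < 1 / (j + 2) := by positivity
    simp only [s]; linarith
  have hmono : Monotone fun j => ball (0 : EuclideanSpace ℝ (Fin n)) (s j) := by
    intro i j hij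
    refine ball_subset_ball ?_
    have : (i : ℝ) ≤ j := by exact_mod_cast hij
    simp only [s]
    gcongr
  have hU : ⋃ j, ball (0 : EuclideanSpace ℝ (Fin n)) (s j) = B n := by
    refine Set.Subset.antisymm (Set.iUnion_subset fun j => ball_subset_ball (hs1 j).le) fun x hx => ?_
    have hx1 : ‖x‖ < 1 := by simpa using hx
    obtain ⟨j, hj⟩ := exists_nat_one_div_lt (sub_pos.2 hx1)
    refine Set.mem_iUnion.2 ⟨j, ?_⟩
    have : (1 : ℝ) / (j + 2) ≤ 1 / (j + 1) := by gcongr; norm_num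
    simp only [mem_ball, dist_zero_right, s]
    linarith
  have hc2 := (continuous_eval_toComplex (homPart F m))
  have hlim := tendsto_setIntegral_of_monotone (μ := volume)
    (f := fun x => ‖MvPolynomial.eval (toComplex x).ofLp (homPart F m)‖ ^ 2)
    (fun j => measurableSet_ball) hmono (by
      rw [hU]
      exact ((hc2.norm.pow 2).continuousOn.integrableOn_compact (isCompact_closedBall 0 1)).mono_set
        ball_subset_closedBall)
  rw [hU] at hlim
  exact le_of_tendsto hlim (Filter.Eventually.of_forall fun j =>
    setIntegral_sq_homPart_le hp hF hpoly hL (hs0 j) (hs1 j) m)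

end Bessel

/-! ### Extension to a common open set and linear structure -/

section Extension

variable {n p : ℕ}

/-- The points near which all homogeneous polynomials decay geometrically in the degree, relative
to their norm on the unit ball of `ℝⁿ`. -/
def decaySet (n : ℕ) : Set (EuclideanSpace ℂ (Fin n)) :=
  {z₀ | ∃ C ρ : ℝ, 0 ≤ C ∧ 0 ≤ ρ ∧ ρ < 1 ∧ ∀ᶠ z in nhds z₀,
    ∀ (m : ℕ) (A : MvPolynomial (Fin n) ℂ),
      A.IsHomogeneous m → ‖MvPolynomial.eval z.ofLp A‖ ≤ C * ρ ^ m * ballNorm A}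

theorem isOpen_decaySet : IsOpen (decaySet n) := by
  rw [isOpen_iff_mem_nhds]
  rintro z₀ ⟨C, ρ, hC, hρ0, hρ1, h⟩
  filter_upwards [h.eventually_nhds] with z hz
  exact ⟨C, ρ, hC, hρ0, hρ1, hz⟩

theorem allRotations_subset_decaySet : allRotations n ⊆ decaySet n := fun _ hz =>
  exists_norm_eval_le hz

theorem hatB_subset_decaySet : hatB n p ⊆ decaySet n :=
  hatB_subset_allRotations.trans allRotations_subset_decaySet

/-- The sum of the homogeneous expansion at `0`. -/
noncomputable def holExt (F : EuclideanSpace ℂ (Fin n) → ℂ) (z : EuclideanSpace ℂ (Fin n)) : ℂ :=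
  ∑' m, MvPolynomial.eval z.ofLp (homPart F m)

theorem holExt_eq {F : EuclideanSpace ℂ (Fin n) → ℂ} (hF : AnalyticOnNhd ℂ F (allRotations n))
    {z : EuclideanSpace ℂ (Fin n)} (hz : z ∈ allRotations n) : holExt F z = F z :=
  (hasSum_homPart hF hz).tsum_eq

theorem exists_bound_homPart {z₀ : EuclideanSpace ℂ (Fin n)} (hz₀ : z₀ ∈ decaySet n) :
    ∃ C ρ : ℝ, 0 ≤ C ∧ 0 ≤ ρ ∧ ρ < 1 ∧ ∀ᶠ z in nhds z₀,
      ∀ (F : EuclideanSpace ℂ (Fin n) → ℂ) (N : ℝ), (∀ m, ballNorm (homPart F m) ≤ N) →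
        ∀ m, ‖MvPolynomial.eval z.ofLp (homPart F m)‖ ≤ C * ρ ^ m * N := by
  obtain ⟨C, ρ, hC, hρ0, hρ1, h⟩ := hz₀
  refine ⟨C, ρ, hC, hρ0, hρ1, h.mono fun z hz F N hN m => ?_⟩
  refine (hz m _ (isHomogeneous_homPart F m)).trans ?_
  gcongr
  exact hN m

theorem summable_geometric_mul {C ρ : ℝ} (hρ0 : 0 ≤ ρ) (hρ1 : ρ < 1) (N : ℝ) :
    Summable fun m : ℕ => C * ρ ^ m * N :=
  ((summable_geometric_of_lt_one hρ0 hρ1).mul_left C).mul_right N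

theorem summable_homPart {z : EuclideanSpace ℂ (Fin n)} (hz : z ∈ decaySet n)
    {F : EuclideanSpace ℂ (Fin n) → ℂ} {N : ℝ} (hN : ∀ m, ballNorm (homPart F m) ≤ N) :
    Summable fun m => MvPolynomial.eval z.ofLp (homPart F m) := by
  obtain ⟨C, ρ, hC, hρ0, hρ1, h⟩ := exists_bound_homPart hz
  exact Summable.of_norm_bounded (summable_geometric_mul hρ0 hρ1 N) (h.self_of_nhds F N hN)

/-- The constant and the neighbourhood do not depend on `F`. This uniformity serves both the
boundedness of evaluation and the convergence of Cauchy sequences. -/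
theorem exists_norm_holExt_le {z₀ : EuclideanSpace ℂ (Fin n)} (hz₀ : z₀ ∈ decaySet n) :
    ∃ D : ℝ, 0 ≤ D ∧ ∀ᶠ z in nhds z₀,
      ∀ (F : EuclideanSpace ℂ (Fin n) → ℂ) (N : ℝ), (∀ m, ballNorm (homPart F m) ≤ N) →
        ‖holExt F z‖ ≤ D * N := by
  obtain ⟨C, ρ, hC, hρ0, hρ1, h⟩ := exists_bound_homPart hz₀
  refine ⟨C * (1 - ρ)⁻¹, mul_nonneg hC (inv_nonneg.2 (by linarith)), h.mono fun z hz F N hN => ?_⟩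
  exact tsum_of_norm_bounded (((hasSum_geometric_of_lt_one hρ0 hρ1).mul_left C).mul_right N)
    (hz F N hN)

theorem tendstoLocallyUniformlyOn_holExt {F : EuclideanSpace ℂ (Fin n) → ℂ} {N : ℝ}
    (hN : ∀ m, ballNorm (homPart F m) ≤ N) :
    TendstoLocallyUniformlyOn
      (fun (j : ℕ) (z : EuclideanSpace ℂ (Fin n)) =>
        MvPolynomial.eval z.ofLp (∑ m ∈ Finset.range j, homPart F m))
      (holExt F) Filter.atTop (decaySet n) := by
  refine tendstoLocallyUniformlyOn_of_forall_exists_nhds fun z₀ hz₀ => ?_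
  obtain ⟨C, ρ, hC, hρ0, hρ1, h⟩ := exists_bound_homPart hz₀
  refine ⟨_, mem_nhdsWithin_of_mem_nhds h, ?_⟩
  simp only [map_sum]
  exact tendstoUniformlyOn_tsum_nat (summable_geometric_mul hρ0 hρ1 N)
    fun m z hz => hz F N hN m

/-- The given `F` is holomorphic only on a neighbourhood that may depend on `F`; its homogeneous
series is holomorphic on the fixed open set `decaySet n`, where limits can be taken. -/
theorem analyticOnNhd_holExt {F : EuclideanSpace ℂ (Fin n) → ℂ} {N : ℝ}
    (hN : ∀ m, ballNorm (homPart F m) ≤ N) : AnalyticOnNhd ℂ (holExt F) (decaySet n) :=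
  (tendstoLocallyUniformlyOn_holExt hN).analyticOnNhd isOpen_decaySet
    fun _ z _ => analyticAt_eval_ofLp _ z

theorem iterate_holLaplacian_holExt {F : EuclideanSpace ℂ (Fin n) → ℂ} {N : ℝ}
    (hN : ∀ m, ballNorm (homPart F m) ≤ N) (hpoly : ∀ m, polyLaplacian^[p] (homPart F m) = 0)
    {z : EuclideanSpace ℂ (Fin n)} (hz : z ∈ decaySet n) :
    holLaplacian^[p] (holExt F) z = 0 := by
  have h := (tendstoLocallyUniformlyOn_holExt hN).iterate_holLaplacian isOpen_decaySet
    (fun _ z _ => analyticAt_eval_ofLp _ z) p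
  simp only [iterate_holLaplacian_eval, iterate_polyLaplacian_sum, hpoly, Finset.sum_const_zero,
    map_zero] at h
  exact tendsto_nhds_unique (h.tendsto_at hz) tendsto_const_nhds

theorem isPolyharmonic_of_holLaplacian {G : EuclideanSpace ℂ (Fin n) → ℂ}
    (hG : AnalyticOnNhd ℂ G (allRotations n))
    (h : ∀ z ∈ allRotations n, holLaplacian^[p] G z = 0) :
    IsPolyharmonic (fun z : hatB n p => G z) := by
  have hB : ∀ x ∈ B n, toComplex x ∈ allRotations n := fun x hx => by
    simpa [rotate] using rotate_mem_allRotations hx 0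
  refine ⟨G, hG, ⟨fun x hx => (hG _ (hB x hx)).comp_toComplex, fun x hx => ?_⟩, fun _ => rfl⟩
  rw [iterate_laplacian_comp_toComplex (hG _ (hB x hx)), h _ (hB x hx)]

theorem IsPolyharmonic.exists_homPart {u : hatB n p → ℂ} (hu : IsPolyharmonic u) :
    ∃ F : EuclideanSpace ℂ (Fin n) → ℂ, AnalyticOnNhd ℂ F (allRotations n) ∧
      (∀ m, polyLaplacian^[p] (homPart F m) = 0) ∧ u = fun z : hatB n p => F z := by
  obtain ⟨F, hF, ⟨_, hlap⟩, huF⟩ := hu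
  refine ⟨F, hF, iterate_polyLaplacian_homPart (hF 0 zero_mem_allRotations) ?_, funext huF⟩
  filter_upwards [ball_mem_nhds (0 : EuclideanSpace ℝ (Fin n)) one_pos] with x hx
  have hx' : toComplex x ∈ allRotations n := by
    simpa [rotate] using rotate_mem_allRotations hx 0
  rw [← iterate_laplacian_comp_toComplex (hF _ hx')]
  exact hlap x hx

/-- Polyharmonicity can be tested on homogeneous parts: the sum of the series is annihilated by the
iterated holomorphic Laplacian and agrees with `F` on the rotated balls. Stability under linear
combinations thereby reduces to polynomials. -/
theorem mem_bergmanSpace [Nontrivial (EuclideanSpace ℝ (Fin n))] (hp : 1 ≤ p)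
    {F : EuclideanSpace ℂ (Fin n) → ℂ} (hF : AnalyticOnNhd ℂ F (allRotations n))
    (hpoly : ∀ m, polyLaplacian^[p] (homPart F m) = 0)
    (hL : MemLp (fun z : hatB n p => F z) 2 (hatMeasure n p)) :
    (fun z : hatB n p => F z) ∈ bergmanSpace n p := by
  refine ⟨?_, hL⟩
  have hN := ballNorm_homPart_le hp hF hpoly hL
  have h := isPolyharmonic_of_holLaplacian (n := n) (p := p)
    ((analyticOnNhd_holExt hN).mono allRotations_subset_decaySet)
    fun z hz => iterate_holLaplacian_holExt hN hpoly (allRotations_subset_decaySet hz)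
  have he : (fun z : hatB n p => F z) = fun z : hatB n p => holExt F z :=
    funext fun z => (holExt_eq hF (hatB_subset_allRotations z.2)).symm
  rwa [he]

theorem add_smul_mem_bergmanSpace [Nontrivial (EuclideanSpace ℝ (Fin n))] (hp : 1 ≤ p)
    {u v : hatB n p → ℂ} (hu : u ∈ bergmanSpace n p) (hv : v ∈ bergmanSpace n p) (a : ℂ) :
    u + a • v ∈ bergmanSpace n p := by
  have hL := hu.2.add (hv.2.const_smul a)
  obtain ⟨F, hF, hFp, rfl⟩ := hu.1.exists_homPart
  obtain ⟨G, hG, hGp, rfl⟩ := hv.1.exists_homPart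
  refine mem_bergmanSpace hp (F := F + a • G) (fun z hz => (hF z hz).add
    (analyticAt_const.smul (hG z hz))) (fun m => ?_) hL
  rw [homPart_add_smul (hF 0 zero_mem_allRotations) (hG 0 zero_mem_allRotations),
    iterate_polyLaplacian_add_C_mul, hFp, hGp, mul_zero, add_zero]

theorem zero_mem_bergmanSpace : (0 : hatB n p → ℂ) ∈ bergmanSpace n p := by
  refine ⟨isPolyharmonic_of_holLaplacian (G := fun _ => 0) (fun _ _ => analyticAt_const)
    fun z _ => ?_, MemLp.zero⟩
  have := congrFun (iterate_holLaplacian_eval (n := n) 0 p) z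
  have h0 : polyLaplacian^[p] (0 : MvPolynomial (Fin n) ℂ) = 0 :=
    Function.iterate_fixed polyLaplacian_zero p
  simpa [h0] using this

end Extension

/-! ### Bounded evaluation and closedness in `L²` -/

section Hilbert

variable {n p : ℕ}

theorem integral_hatMeasure {f : hatB n p → ℂ} (hp : 1 ≤ p) (hf : Integrable f (hatMeasure n p)) :
    ∫ z, f z ∂(hatMeasure n p) = (1 / (p : ℂ)) * ∑ k : Fin p, ∫ y, f (rot k y) ∂(volB n) := by
  have hk : ∀ k : Fin p, Integrable f (Measure.map (rot k) (volB n)) := fun k =>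
    hf.of_measure_le_smul (c := (p : ℝ≥0∞)) (by finiteness) (map_rot_le hp k)
  rw [hatMeasure, integral_smul_measure, integral_finsetSum_measure fun k _ => hk k]
  simp only [fun k => integral_map (continuous_rot (n := n) (p := p) k).measurable.aemeasurable
    (hk k).1]
  simp

/-- The arguments are swapped because `inner` is conjugate linear in its first variable and
`pairing` in its second. -/
theorem inner_toLp (hp : 1 ≤ p) {u v : hatB n p → ℂ} (hu : MemLp u 2 (hatMeasure n p))
    (hv : MemLp v 2 (hatMeasure n p)) :
    inner ℂ (hv.toLp v) (hu.toLp u) = pairing u v := by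
  have hint : Integrable (fun z => u z * (starRingEnd ℂ) (v z)) (hatMeasure n p) :=
    hu.integrable_mul hv.star
  rw [pairing, ← integral_hatMeasure hp hint, L2.inner_def]
  refine integral_congr_ae ?_
  filter_upwards [hu.coeFn_toLp, hv.coeFn_toLp] with z h1 h2
  rw [h1, h2, RCLike.inner_apply]

theorem pairing_self (u : hatB n p → ℂ) : pairing u u = ((bergmanNorm u ^ 2 : ℝ) : ℂ) := by
  rw [bergmanNorm_sq, pairing]
  push_cast
  congr 1
  refine Finset.sum_congr rfl fun k _ => ?_
  rw [← integral_complex_ofReal]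
  refine integral_congr_ae (Filter.Eventually.of_forall fun y => ?_)
  simp only [Complex.mul_conj']
  push_cast
  rfl

theorem norm_toLp_eq (hp : 1 ≤ p) {u : hatB n p → ℂ} (hu : MemLp u 2 (hatMeasure n p)) :
    ‖hu.toLp u‖ = bergmanNorm u := by
  have h := inner_toLp hp hu hu
  rw [pairing_self, inner_self_eq_norm_sq_to_K] at h
  have h2 : ‖hu.toLp u‖ ^ 2 = bergmanNorm u ^ 2 := by
    rw [RCLike.ofReal_eq_complex_ofReal] at h
    exact_mod_cast h
  exact (sq_eq_sq₀ (norm_nonneg _) (Real.sqrt_nonneg _)).1 h2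

theorem pairing_conj_symm (hp : 1 ≤ p) {u v : hatB n p → ℂ} (hu : MemLp u 2 (hatMeasure n p))
    (hv : MemLp v 2 (hatMeasure n p)) : pairing u v = (starRingEnd ℂ) (pairing v u) := by
  rw [← inner_toLp hp hu hv, ← inner_toLp hp hv hu, inner_conj_symm]

theorem integrable_mul_conj_comp_rot (hp : 1 ≤ p) {u v : hatB n p → ℂ}
    (hu : MemLp u 2 (hatMeasure n p)) (hv : MemLp v 2 (hatMeasure n p)) (k : Fin p) :
    Integrable (fun y : B n => u (rot k y) * (starRingEnd ℂ) (v (rot k y))) (volB n) :=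
  (hu.comp_rot hp k).integrable_mul (hv.comp_rot hp k).star

variable [Nontrivial (EuclideanSpace ℝ (Fin n))]

/-- The value at `x` is the sum of the homogeneous series, which decays geometrically relative to
the norms of its parts; the Bessel inequality bounds these by `bergmanNorm u`. -/
theorem exists_norm_apply_le (hp : 1 ≤ p) (x : hatB n p) :
    ∃ D : ℝ, ∀ u ∈ bergmanSpace n p, ‖u x‖ ≤ D * bergmanNorm u := by
  obtain ⟨D, _, hD⟩ := exists_norm_holExt_le (hatB_subset_decaySet x.2)
  refine ⟨D, fun u hu => ?_⟩
  have hL := hu.2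
  obtain ⟨F, hF, hFp, rfl⟩ := hu.1.exists_homPart
  have h := hD.self_of_nhds F _ (ballNorm_homPart_le hp hF hFp hL)
  rwa [holExt_eq hF (hatB_subset_allRotations x.2)] at h

theorem sub_mem_bergmanSpace (hp : 1 ≤ p) {u v : hatB n p → ℂ} (hu : u ∈ bergmanSpace n p)
    (hv : v ∈ bergmanSpace n p) : u - v ∈ bergmanSpace n p := by
  have h := add_smul_mem_bergmanSpace hp hu hv (-1)
  rwa [neg_one_smul, ← sub_eq_add_neg] at h

/-- The difference has norm `0`, so bounded evaluation makes it vanish at every point. Classes in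
`L²` thus have a unique polyharmonic representative. -/
theorem eq_of_ae_eq (hp : 1 ≤ p) {u v : hatB n p → ℂ} (hu : u ∈ bergmanSpace n p)
    (hv : v ∈ bergmanSpace n p) (h : u =ᵐ[hatMeasure n p] v) : u = v := by
  have hs := sub_mem_bergmanSpace hp hu hv
  have h0 : bergmanNorm (u - v) = 0 := by
    rw [← norm_toLp_eq hp hs.2, MemLp.toLp_sub hu.2 hv.2, (MemLp.toLp_eq_toLp_iff hu.2 hv.2).2 h,
      sub_self, norm_zero]
  ext x
  obtain ⟨D, hD⟩ := exists_norm_apply_le hp x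
  have := hD _ hs
  rw [h0, mul_zero, norm_le_zero_iff] at this
  exact sub_eq_zero.1 this

/-- The Bergman space as a subspace of `L²`. -/
noncomputable def bergmanSubmodule (hp : 1 ≤ p) : Submodule ℂ (L2 n p) where
  carrier := bergmanL2 n p
  add_mem' := by
    rintro f g ⟨u, hu, hfu⟩ ⟨v, hv, hgv⟩
    refine ⟨u + (1 : ℂ) • v, add_smul_mem_bergmanSpace hp hu hv 1, ?_⟩
    rw [one_smul]
    exact (Lp.coeFn_add f g).trans (hfu.add hgv)
  zero_mem' := ⟨0, zero_mem_bergmanSpace, Lp.coeFn_zero _ _ _⟩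
  smul_mem' := by
    rintro a f ⟨u, hu, hfu⟩
    refine ⟨0 + a • u, add_smul_mem_bergmanSpace hp zero_mem_bergmanSpace hu a, ?_⟩
    rw [zero_add]
    exact (Lp.coeFn_smul a f).trans (hfu.const_smul a)

/-- Norm convergence of Bergman functions forces locally uniform convergence of extensions. -/
theorem exists_tendstoLocallyUniformlyOn_holExt (hp : 1 ≤ p)
    {F : ℕ → EuclideanSpace ℂ (Fin n) → ℂ} (hF : ∀ j, AnalyticOnNhd ℂ (F j) (allRotations n))
    (hFp : ∀ j m, polyLaplacian^[p] (homPart (F j) m) = 0)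
    (hL : ∀ j, MemLp (fun z : hatB n p => F j z) 2 (hatMeasure n p))
    (hc : CauchySeq fun j => (hL j).toLp) :
    ∃ G : EuclideanSpace ℂ (Fin n) → ℂ,
      TendstoLocallyUniformlyOn (fun j => holExt (F j)) G Filter.atTop (decaySet n) := by
  have hN := fun j => ballNorm_homPart_le hp (hF j) (hFp j) (hL j)
  have hsub : ∀ i j, F i - F j = F i + (-1 : ℂ) • F j := fun i j => by
    rw [neg_one_smul, sub_eq_add_neg]
  have hpart : ∀ i j m, homPart (F i - F j) m =
      homPart (F i) m + MvPolynomial.C (-1) * homPart (F j) m := fun i j m => by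
    rw [hsub, homPart_add_smul (hF i 0 zero_mem_allRotations) (hF j 0 zero_mem_allRotations)]
  -- The Bessel inequality is applied to the difference, which is again polyharmonic, so its parts
  -- are controlled by the `L²` distance.
  have hNsub : ∀ i j m, ballNorm (homPart (F i - F j) m) ≤ dist ((hL i).toLp) ((hL j).toLp) := by
    intro i j m
    have h := ballNorm_homPart_le hp (F := F i - F j) ((hF i).sub (hF j)) (fun m => by
      rw [hpart, iterate_polyLaplacian_add_C_mul, hFp, hFp, mul_zero, add_zero])
      ((hL i).sub (hL j)) m
    have hd := norm_toLp_eq hp ((hL i).sub (hL j))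
    rw [MemLp.toLp_sub (hL i) (hL j), ← dist_eq_norm] at hd
    exact h.trans_eq hd.symm
  have hext : ∀ i j, ∀ z ∈ decaySet n, holExt (F i - F j) z = holExt (F i) z - holExt (F j) z := by
    intro i j z hz
    rw [holExt, holExt, holExt, ← (summable_homPart hz (hN i)).tsum_sub (summable_homPart hz (hN j))]
    congr 1
    ext m
    rw [hpart]
    simp [sub_eq_add_neg]
  have hloc : ∀ (z₀) (hz₀ : z₀ ∈ decaySet n), UniformCauchySeqOn (fun j => holExt (F j)) Filter.atTop
      ({z | ∀ i j, ‖holExt (F i - F j) z‖ ≤ (exists_norm_holExt_le hz₀).choose *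
        dist ((hL i).toLp) ((hL j).toLp)} ∩ decaySet n) := by
    intro z₀ hz₀
    set D := (exists_norm_holExt_le hz₀).choose
    have hD : 0 ≤ D := (exists_norm_holExt_le hz₀).choose_spec.1
    rw [Metric.uniformCauchySeqOn_iff]
    intro ε hε
    obtain ⟨N, hN⟩ := Metric.cauchySeq_iff.1 hc (ε / (D + 1)) (by positivity)
    refine ⟨N, fun i hi j hj z hz => ?_⟩
    rw [dist_eq_norm, ← hext i j z hz.2]
    have h1 := hN i hi j hj
    rw [lt_div_iff₀ (by positivity)] at h1
    refine (hz.1 i j).trans_lt (lt_of_le_of_lt ?_ h1)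
    rw [mul_comm]
    gcongr
    linarith
  have hmem : ∀ (z₀) (hz₀ : z₀ ∈ decaySet n),
      {z | ∀ i j, ‖holExt (F i - F j) z‖ ≤ (exists_norm_holExt_le hz₀).choose *
        dist ((hL i).toLp) ((hL j).toLp)} ∩ decaySet n ∈ nhds z₀ := fun z₀ hz₀ =>
    Filter.inter_mem ((exists_norm_holExt_le hz₀).choose_spec.2.mono
      fun z hz i j => hz _ _ (hNsub i j)) (isOpen_decaySet.mem_nhds hz₀)
  -- Outside `decaySet n` the limit function takes the irrelevant value `0`.
  have hpt : ∀ z, ∃ l, z ∈ decaySet n → Filter.Tendsto (fun j => holExt (F j) z) Filter.atTop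
      (nhds l) := by
    intro z
    by_cases hz : z ∈ decaySet n
    · obtain ⟨l, hl⟩ := cauchySeq_tendsto_of_complete
        ((hloc z hz).cauchySeq (mem_of_mem_nhds (hmem z hz)))
      exact ⟨l, fun _ => hl⟩
    · exact ⟨0, fun h => absurd h hz⟩
  choose G hG using hpt
  refine ⟨G, tendstoLocallyUniformlyOn_of_forall_exists_nhds fun z₀ hz₀ =>
    ⟨_, mem_nhdsWithin_of_mem_nhds (hmem z₀ hz₀), ?_⟩⟩
  exact (hloc z₀ hz₀).tendstoUniformlyOn_of_tendsto fun z hz => hG z hz.2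

/-- The extensions converge locally uniformly on the open set `decaySet n`, so their limit is
holomorphic and annihilated by the iterated Laplacian. An almost everywhere convergent subsequence
identifies it with the `L²` limit. -/
theorem isClosed_bergmanL2 (hp : 1 ≤ p) : IsClosed (bergmanL2 n p) := by
  refine IsSeqClosed.isClosed fun f g hf hfg => ?_
  choose u hu hfu using hf
  choose F hF hFp huF using fun j => (hu j).1.exists_homPart
  have hL : ∀ j, MemLp (fun z : hatB n p => F j z) 2 (hatMeasure n p) := fun j => by
    rw [← huF j]; exact (hu j).2
  have hfL : ∀ j, (hL j).toLp = f j := fun j => by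
    refine Lp.ext ((hL j).coeFn_toLp.trans ?_)
    rw [← huF j]
    exact (hfu j).symm
  have hfL' : (fun j => (hL j).toLp) = f := funext hfL
  obtain ⟨G, hG⟩ := exists_tendstoLocallyUniformlyOn_holExt hp hF hFp hL
    (by rw [hfL']; exact hfg.cauchySeq)
  have hN := fun j => ballNorm_homPart_le hp (hF j) (hFp j) (hL j)
  have hGan : AnalyticOnNhd ℂ G (decaySet n) :=
    hG.analyticOnNhd isOpen_decaySet fun j => analyticOnNhd_holExt (hN j)
  have hGlap : ∀ z ∈ decaySet n, holLaplacian^[p] G z = 0 := fun z hz => by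
    have h := (hG.iterate_holLaplacian isOpen_decaySet
      (fun j => analyticOnNhd_holExt (hN j)) p).tendsto_at hz
    simp only [fun j => iterate_holLaplacian_holExt (hN j) (hFp j) hz] at h
    exact tendsto_nhds_unique h tendsto_const_nhds
  obtain ⟨ns, hns, hae⟩ := (tendstoInMeasure_of_tendsto_Lp hfg).exists_seq_tendsto_ae
  have hgG : (g : hatB n p → ℂ) =ᵐ[hatMeasure n p] fun z : hatB n p => G z := by
    filter_upwards [hae, ae_all_iff.2 hfu] with z h1 h2
    refine tendsto_nhds_unique h1 ?_
    have h3 := (hG.tendsto_at (hatB_subset_decaySet z.2)).comp hns.tendsto_atTop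
    refine h3.congr fun j => ?_
    rw [h2, huF, Function.comp, holExt_eq (hF _) (hatB_subset_allRotations z.2)]
  refine ⟨fun z => G z, ⟨isPolyharmonic_of_holLaplacian
    (hGan.mono allRotations_subset_decaySet)
    fun z hz => hGlap z (allRotations_subset_decaySet hz), ?_⟩, hgG⟩
  exact (memLp_congr_ae hgG).1 (Lp.memLp g)

end Hilbert

/-! ### The reproducing kernel and the projection -/

section Kernel

variable {n p : ℕ} [Nontrivial (EuclideanSpace ℝ (Fin n))]

theorem toLp_mem_bergmanSubmodule (hp : 1 ≤ p) {u : hatB n p → ℂ} (hu : u ∈ bergmanSpace n p) :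
    hu.2.toLp ∈ bergmanSubmodule (n := n) hp :=
  ⟨u, hu, hu.2.coeFn_toLp⟩

/-- The polyharmonic representative of an element of the Bergman space. -/
noncomputable def rep (hp : 1 ≤ p) (f : bergmanSubmodule (n := n) hp) : hatB n p → ℂ :=
  f.2.choose

theorem rep_mem (hp : 1 ≤ p) (f : bergmanSubmodule (n := n) hp) : rep hp f ∈ bergmanSpace n p :=
  f.2.choose_spec.1

theorem coe_ae_eq_rep (hp : 1 ≤ p) (f : bergmanSubmodule (n := n) hp) :
    ((f : L2 n p) : hatB n p → ℂ) =ᵐ[hatMeasure n p] rep hp f :=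
  f.2.choose_spec.2

theorem rep_eq (hp : 1 ≤ p) {f : bergmanSubmodule (n := n) hp} {u : hatB n p → ℂ}
    (hu : u ∈ bergmanSpace n p) (h : ((f : L2 n p) : hatB n p → ℂ) =ᵐ[hatMeasure n p] u) :
    rep hp f = u :=
  eq_of_ae_eq hp (rep_mem hp f) hu ((coe_ae_eq_rep hp f).symm.trans h)

theorem toLp_rep (hp : 1 ≤ p) (f : bergmanSubmodule (n := n) hp) :
    (rep_mem hp f).2.toLp = (f : L2 n p) :=
  Lp.ext ((rep_mem hp f).2.coeFn_toLp.trans (coe_ae_eq_rep hp f).symm)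

theorem rep_add_smul (hp : 1 ≤ p) (f g : bergmanSubmodule (n := n) hp) (a : ℂ) :
    rep hp (f + a • g) = rep hp f + a • rep hp g := by
  refine rep_eq hp (add_smul_mem_bergmanSpace hp (rep_mem hp f) (rep_mem hp g) a) ?_
  rw [Submodule.coe_add, Submodule.coe_smul]
  exact (Lp.coeFn_add _ _).trans ((coe_ae_eq_rep hp f).add
    ((Lp.coeFn_smul _ _).trans ((coe_ae_eq_rep hp g).const_smul a)))

theorem rep_zero (hp : 1 ≤ p) : rep (n := n) hp 0 = 0 :=
  rep_eq hp zero_mem_bergmanSpace (Lp.coeFn_zero _ _ _)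

/-- Evaluation at a point as a continuous functional on the Bergman space. -/
noncomputable def evalCLM (hp : 1 ≤ p) (x : hatB n p) : bergmanSubmodule (n := n) hp →L[ℂ] ℂ :=
  LinearMap.mkContinuous
    { toFun := fun f => rep hp f x
      map_add' := fun f g => by
        have := congrFun (rep_add_smul hp f g 1) x
        simpa using this
      map_smul' := fun a f => by
        have := congrFun (rep_add_smul hp 0 f a) x
        simpa [rep_zero hp] using this }
    (exists_norm_apply_le hp x).choose
    fun f => by
      have h := (exists_norm_apply_le hp x).choose_spec _ (rep_mem hp f)
      rw [← norm_toLp_eq hp (rep_mem hp f).2, toLp_rep] at h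
      exact h

instance (hp : 1 ≤ p) : CompleteSpace (bergmanSubmodule (n := n) hp) :=
  (isClosed_bergmanL2 (n := n) hp).completeSpace_coe

/-- Riesz representation for the evaluation functional, on a Bergman space that is complete because
it is closed in `L²`. -/
theorem exists_represents (hp : 1 ≤ p) (x : hatB n p) : ∃ r, Represents x r := by
  set k := (InnerProductSpace.toDual ℂ (bergmanSubmodule (n := n) hp)).symm (evalCLM hp x) with hk
  refine ⟨rep hp k, rep_mem hp k, fun u hu => ?_⟩
  have h1 : inner ℂ k ⟨hu.2.toLp, toLp_mem_bergmanSubmodule hp hu⟩ = u x := by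
    rw [hk, InnerProductSpace.toDual_symm_apply]
    exact congrFun (rep_eq hp hu hu.2.coeFn_toLp) x
  rw [← h1, ← inner_toLp hp hu.2 (rep_mem hp k).2, toLp_rep]
  rfl

theorem represents_bergmanKernel (hp : 1 ≤ p) (x : hatB n p) :
    Represents x (bergmanKernel x) :=
  Classical.epsilon_spec (exists_represents hp x)

/-- Testing both representers against their difference shows that it has inner product `0` with
itself. -/
theorem Represents.eq (hp : 1 ≤ p) {x : hatB n p} {r s : hatB n p → ℂ} (hr : Represents x r)
    (hs : Represents x s) : r = s := by
  refine eq_of_ae_eq hp hr.1 hs.1 ((MemLp.toLp_eq_toLp_iff hr.1.2 hs.1.2).1 ?_)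
  have hd := sub_mem_bergmanSpace hp hr.1 hs.1
  have h : inner ℂ (hr.1.2.toLp r - hs.1.2.toLp s) (hr.1.2.toLp r - hs.1.2.toLp s) = (0 : ℂ) := by
    rw [inner_sub_left, ← MemLp.toLp_sub hr.1.2 hs.1.2, inner_toLp hp hd.2, inner_toLp hp hd.2,
      ← hr.2 _ hd, ← hs.2 _ hd, sub_self]
  exact sub_eq_zero.1 (inner_self_eq_zero.1 h)

/-- Each kernel function is evaluated through the other one, and the pairing is Hermitian. -/
theorem bergmanKernel_conj_symm (hp : 1 ≤ p) (x y : hatB n p) :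
    bergmanKernel x y = (starRingEnd ℂ) (bergmanKernel y x) := by
  have hx := represents_bergmanKernel hp x
  have hy := represents_bergmanKernel hp y
  rw [hy.2 _ hx.1, hx.2 _ hy.1]
  exact pairing_conj_symm hp hx.1.2 hy.1.2

/-- Since the kernel at `x` lies in the Bergman space, its inner products with `u` and with the
projection of `u` agree; the latter is the value at `x` of the polyharmonic representative. -/
theorem Q_eq_rep (hp : 1 ≤ p) (u : L2 n p) :
    Q u = rep hp ((bergmanSubmodule (n := n) hp).orthogonalProjectionOnto u) := by
  ext x
  set f := (bergmanSubmodule (n := n) hp).orthogonalProjectionOnto u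
  have hx := represents_bergmanKernel hp x
  rw [hx.2 _ (rep_mem hp f), ← inner_toLp hp (rep_mem hp f).2 hx.1.2, toLp_rep]
  have h : Q u x = inner ℂ (hx.1.2.toLp) u := by
    have := inner_toLp hp (Lp.memLp u) hx.1.2
    rw [Lp.toLp_coeFn] at this
    exact this.symm
  rw [h]
  exact (Submodule.inner_orthogonalProjectionOnto_eq_of_mem_left
    (⟨_, toLp_mem_bergmanSubmodule hp hx.1⟩ : bergmanSubmodule (n := n) hp) (u : L2 n p)).symm

end Kernel

end PolyBergman

theorem proposition5 (n p : ℕ) (hn : 1 ≤ n) (hp : 1 ≤ p) :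
    -- the kernel is well defined: it is the only representer of the evaluation at each point
    (∀ (x : PolyBergman.hatB n p) (r : PolyBergman.hatB n p → ℂ),
      PolyBergman.Represents x r ↔ r = PolyBergman.bergmanKernel x) ∧
    -- (1) Hermitian symmetry
    (∀ x y : PolyBergman.hatB n p,
      PolyBergman.bergmanKernel x y = (starRingEnd ℂ) (PolyBergman.bergmanKernel y x)) ∧
    -- (2) the norm of the kernel
    (∀ x : PolyBergman.hatB n p,
      ((PolyBergman.bergmanNorm (PolyBergman.bergmanKernel x) ^ 2 : ℝ) : ℂ) =
        PolyBergman.bergmanKernel x x) ∧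
    -- (3) the integrals defining `Q[u]` converge, `Q[u]` lies in the Bergman space,
    (∀ (u : PolyBergman.L2 n p) (x : PolyBergman.hatB n p) (k : Fin p),
      MeasureTheory.Integrable (fun y : PolyBergman.B n =>
        u (PolyBergman.rot k y) *
          (starRingEnd ℂ) (PolyBergman.bergmanKernel x (PolyBergman.rot k y)))
        (PolyBergman.volB n)) ∧
    (∀ u : PolyBergman.L2 n p, PolyBergman.Q u ∈ PolyBergman.bergmanSpace n p) ∧
    -- and `Q` is the unique orthogonal projection of `L²` onto the Bergman space
    (∃ T : PolyBergman.L2 n p →ₗ[ℂ] PolyBergman.L2 n p,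
      (∀ u : PolyBergman.L2 n p,
        (T u : PolyBergman.hatB n p → ℂ) =ᵐ[PolyBergman.hatMeasure n p] PolyBergman.Q u) ∧
      (T.IsSymmetricProjection ∧ (LinearMap.range T : Set _) = PolyBergman.bergmanL2 n p) ∧
      ∀ T' : PolyBergman.L2 n p →ₗ[ℂ] PolyBergman.L2 n p,
        T'.IsSymmetricProjection ∧ (LinearMap.range T' : Set _) = PolyBergman.bergmanL2 n p →
          T' = T) := by
  have : Nontrivial (EuclideanSpace ℝ (Fin n)) :=
    Module.nontrivial_of_finrank_pos (R := ℝ) (by simpa using Nat.lt_of_succ_le hn)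
  have hR := fun x : PolyBergman.hatB n p => PolyBergman.represents_bergmanKernel hp x
  set K := PolyBergman.bergmanSubmodule (n := n) hp
  have hrange : (LinearMap.range (K.starProjection : PolyBergman.L2 n p →ₗ[ℂ] PolyBergman.L2 n p) :
      Set (PolyBergman.L2 n p)) = PolyBergman.bergmanL2 n p :=
    congrArg SetLike.coe (Submodule.range_starProjection K)
  have hsym := Submodule.isSymmetricProjection_starProjection K
  refine ⟨fun x r => ⟨fun h => h.eq hp (hR x), fun h => h ▸ hR x⟩,
    PolyBergman.bergmanKernel_conj_symm hp, fun x => ?_,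
    fun u x k => PolyBergman.integrable_mul_conj_comp_rot hp (Lp.memLp u) (hR x).1.2 k,
    fun u => ?_, K.starProjection, fun u => ?_, ⟨hsym, hrange⟩, fun T' hT' => ?_⟩
  -- The reproducing property is applied to the kernel function itself.
  · rw [← PolyBergman.pairing_self, ← (hR x).2 _ (hR x).1]
  · rw [PolyBergman.Q_eq_rep hp u]
    exact PolyBergman.rep_mem hp _
  · rw [PolyBergman.Q_eq_rep hp u]
    exact PolyBergman.coe_ae_eq_rep hp _
  -- A symmetric projection is determined by its range.
  · exact (hT'.1.ext_iff hsym).2 (SetLike.coe_injective (hT'.2.trans hrange.symm))
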